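/- **Setting.** Let $n\ge 1$, let $\mu$ be Lebesgue measure on $\mathbb R^n$, and let $d_\mu(A,B)=\mu(A\Delta B)$. Let $\mathfrak L_n$ be the collection of Lebesgue measurable subsets of $\mathbb R^n$ of finite measure, with the (pseudo-)metric $d_\mu$. Put $\operatorname{ci}(A)=\overline{\operatorname{int}A}$, and let $\mathfrak J_n\subset\mathfrak L_n$ be the collection of bounded sets $A$ with $A=\operatorname{ci}(A)$ and $\mu(\partial A)=0$. **The measure average** $tA\oplus(1-t)B$ of $A,B\in\mathfrak J_n$, $t\in\mathbb R$, is defined in steps. Let $d_S(p,A)=d(p,\partial A)$ for $p\in A$ and $d_S(p,A)=-d(p,\partial A)$ for $p\notin A$. 1. *Distance average.* For $A,B$ not both empty and $x\in\mathbb R$ let $xA\,\tilde\oplus\,(1-x)B=\{p: f_{A,B,x}(p)\ge 0\}$ with $f_{A,B,x}(p)=x\,d_S(p,A)+(1-x)\,d_S(p,B)$. If exactly one of the sets is empty, its signed distance is replaced by $-\|p-q\|$, where $q$ is a chosen point of the other set at which the signed distance to that set is maximal over that set. The distance average of two empty sets is empty. Let $h(x)=\mu(xA\,\tilde\oplus\,(1-x)B)$.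 2. *A single piece.* Let $B\subsetneq A$, and let $m_t=t\mu(A)+(1-t)\mu(B)$. If $\mu\{f_{A,B,1/2}=0\}=0$ or $t\notin[0,1]$, put $tA\oplus_0(1-t)B=\operatorname{ci}\big(g A\,\tilde\oplus\,(1-g)B\big)$, where $g=g(t)$ is any minimizer of $|h(\xi)-m_t|$ over $\xi\in[-N,N]$, for a fixed $N=N(A,B)\ge1$. Otherwise put $tA\oplus_0(1-t)B=\operatorname{ci}\big(\{p:d(p,B)\le r\}\cap A\big)$, where $r=r(t)\ge 0$ is any number with $\mu(\{p:d(p,B)\le r\}\cap A)=m_t$. 3. *Nested sets.* Let $B\subsetneq A$. If $A\setminus B$ has finitely many connected components, let $\mathcal T$ consist of the sets $B\cup C$, $C$ a component of $A\setminus B$. If it has infinitely many, fix $\varepsilon=\varepsilon(A,B)>0$ and let $\mathcal T$ consist of the sets $\operatorname{ci}(B\cup C)$ for the components $C$ with $\mu(C)\ge\varepsilon$, and of $\operatorname{ci}(B\cup U)$, where $U$ is the union of all the other components. With $R_{T,t}=tT\oplus_0(1-t)B$, put $tA\oplus(1-t)B=\bigcup_{T\in\mathcal T}R_{T,t}$ for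 $t\ge0$ and $tA\oplus(1-t)B=\operatorname{ci}\big(\bigcap_{T\in\mathcal T}R_{T,t}\big)$ for $t<0$. Also $tA\oplus(1-t)A=A$. 4. *General sets.* Using step 3, put $R_{1,t}=tA\oplus(1-t)\operatorname{ci}(A\cap B)$ and $R_{2,t}=(1-t)B\oplus t\operatorname{ci}(A\cap B)$. Then $tA\oplus(1-t)B$ is $R_{1,t}\cup R_{2,t}$ for $t\in[0,1]$; it is $\operatorname{ci}\big(R_{1,t}\setminus(A\cap B)\big)\cup R_{2,t}$ for $t>1$; and for $t<0$ it is $(1-t)B\oplus tA$, the previous case with the two sets exchanged. **The 4-point scheme.** Let $w\in\mathbb R$ and let $\{F_i^0\}_{i\in\mathbb Z}\subset\mathfrak J_n$. For $k\ge0$ and $i\in\mathbb Z$ put $$F^{k+1}_{2i}=F^k_i,\qquad F^{k+1}_{2i+1}=\tfrac12E\oplus\tfrac12H,$$ $$E=(-2w)F^k_{i-1}\oplus(1+2w)F^k_i,\qquad H=(-2w)F^k_{i+2}\oplus(1+2w)F^k_{i+1}.$$ Let $d_k=\sup_{i}d_\mu(F^k_i,F^k_{i+1})\in[0,\infty]$,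 and let $F_k:\mathbb R\to\mathfrak J_n$ be the piecewise interpolant $$F_k(x)=\lambda F^k_i\oplus(1-\lambda)F^k_{i+1},\qquad \lambda=(i+1)-2^kx,\qquad i2^{-k}\le x<(i+1)2^{-k}.$$ **Theorem.** For every choice of the free parameters in the measure average, all the sets $F_i^k$ and $F_k(x)$ belong to $\mathfrak J_n$, and $$d_k\le\left(\tfrac12+4|w|\right)^kd_0\qquad\text{for all }k\ge0;$$ for $w\ge0$ this is the bound $d_k\le(\frac12+4w)^kd_0$. If moreover $d_0<\infty$ and $|w|<\frac18$ (in particular, if $d_0<\infty$ and $0\le w<\frac18$), then the sequence $\{F_k\}$ converges uniformly on $\mathbb R$ with respect to $d_\mu$ to a continuous set-valued function $F^\infty:\mathbb R\to\mathfrak L_n$. -/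

import Mathlib

open MeasureTheory Set Filter Topology
open scoped symmDiff ENNReal

noncomputable section

namespace SetSubdivision

/-- The space `ℝⁿ` with the Euclidean norm (and Lebesgue measure `volume`). -/
abbrev E (n : ℕ) : Type := EuclideanSpace ℝ (Fin n)

/-- The collection `𝔏ₙ` of Lebesgue measurable subsets of `ℝⁿ` of finite measure. -/
def LSet (n : ℕ) : Type :=
  {A : Set (E n) // NullMeasurableSet A volume ∧ volume A ≠ ⊤}

/-- The symmetric difference distance `d_μ(A, B) = μ(A Δ B)`, with values in `[0, ∞]`. -/
def dMu {n : ℕ} (A B : Set (E n)) : ℝ≥0∞ := volume (A ∆ B)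

theorem dMu_ne_top {n : ℕ} {A B : Set (E n)} (hA : volume A ≠ ⊤) (hB : volume B ≠ ⊤) :
    dMu A B ≠ ⊤ := by
  have h : dMu A B ≤ volume A + volume B :=
    (measure_mono symmDiff_subset_union).trans (measure_union_le A B)
  exact ne_top_of_le_ne_top (ENNReal.add_ne_top.2 ⟨hA, hB⟩) h

/-- `𝔏ₙ` with the (pseudo-)metric `d_μ`. -/
instance (n : ℕ) : PseudoMetricSpace (LSet n) where
  dist A B := (dMu A.1 B.1).toReal
  dist_self A := by simp [dMu]
  dist_comm A B := by simp [dMu, symmDiff_comm]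
  dist_triangle A B C := by
    have hAB := dMu_ne_top A.2.2 B.2.2
    have hBC := dMu_ne_top B.2.2 C.2.2
    rw [← ENNReal.toReal_add hAB hBC]
    exact ENNReal.toReal_mono (ENNReal.add_ne_top.2 ⟨hAB, hBC⟩)
      (measure_symmDiff_le A.1 B.1 C.1)

/-- `ci A`: the closure of the interior of `A`. -/
def ci {n : ℕ} (A : Set (E n)) : Set (E n) := closure (interior A)

/-- The collection `𝔍ₙ` of regular compact Jordan measurable sets: bounded sets `A` with
`A = ci A` whose boundary is a null set. -/
def JSet (n : ℕ) : Set (Set (E n)) :=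
  {A | Bornology.IsBounded A ∧ A = ci A ∧ volume (frontier A) = 0}

theorem JSet.isClosed {n : ℕ} {A : Set (E n)} (hA : A ∈ JSet n) : IsClosed A := by
  rw [hA.2.1]; exact isClosed_closure

theorem JSet.isCompact {n : ℕ} {A : Set (E n)} (hA : A ∈ JSet n) : IsCompact A :=
  Metric.isCompact_of_isClosed_isBounded (JSet.isClosed hA) hA.1

/-- The inclusion of `𝔍ₙ` in `𝔏ₙ`. -/
def JSet.toL {n : ℕ} (A : Set (E n)) (hA : A ∈ JSet n) : LSet n :=
  ⟨A, (JSet.isClosed hA).measurableSet.nullMeasurableSet, hA.1.measure_lt_top.ne⟩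

open Classical in
/-- The signed distance `d_S(p, A)` from a point to a non-empty set: the distance to the
boundary, positive in `A` and negative outside `A`. -/
def signedDist {n : ℕ} (p : E n) (A : Set (E n)) : ℝ :=
  if p ∈ A then Metric.infDist p (frontier A) else -Metric.infDist p (frontier A)

/-- `q` is a center of `A`: a point of `A` at which the signed distance attains its maximum
over `A`. -/
def IsCenter {n : ℕ} (A : Set (E n)) (q : E n) : Prop :=
  q ∈ A ∧ ∀ a ∈ A, signedDist a A ≤ signedDist q A

theorem exists_isCenter {n : ℕ} {A : Set (E n)} (hA : A ∈ JSet n) (hne : A.Nonempty) :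
    ∃ q, IsCenter A q := by
  obtain ⟨q, hq, hmax⟩ := (JSet.isCompact hA).exists_isMaxOn hne
    (Metric.continuous_infDist_pt (frontier A)).continuousOn
  refine ⟨q, hq, fun a ha => ?_⟩
  simpa [signedDist, ha, hq] using hmax ha

/-- The parameters that the construction of the measure average leaves free: a center for each
non-empty set, the (large) bound `N` of the interval in which the averaging parameter is sought,
and the threshold `ε` below which components are joined when there are infinitely many. The
last two may depend on the pair of sets. -/
structure Params (n : ℕ) where
  center : Set (E n) → E n
  center_spec : ∀ A ∈ JSet n, A.Nonempty → IsCenter A (center A)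
  N : Set (E n) → Set (E n) → ℝ
  one_le_N : ∀ A B, 1 ≤ N A B
  eps : Set (E n) → Set (E n) → ℝ
  eps_pos : ∀ A B, 0 < eps A B

open Classical in
/-- The signed distance from `p` to `A` as an operand of an average with `B`. If `A` is empty, it
is replaced by minus the distance to the center of `B`. -/
def Params.operandDist {n : ℕ} (π : Params n) (A B : Set (E n)) (p : E n) : ℝ :=
  if A = ∅ then -‖p - π.center B‖ else signedDist p A

/-- `f_{A,B,x}(p) = x d_S(p, A) + (1 - x) d_S(p, B)`. -/
def Params.f {n : ℕ} (π : Params n) (A B : Set (E n)) (x : ℝ) (p : E n) : ℝ :=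
  x * π.operandDist A B p + (1 - x) * π.operandDist B A p

open Classical in
/-- The distance average of `A` and `B` with parameter `x`. -/
def Params.distAvg {n : ℕ} (π : Params n) (x : ℝ) (A B : Set (E n)) : Set (E n) :=
  if A = ∅ ∧ B = ∅ then ∅ else {p | 0 ≤ π.f A B x p}

/-- `h(x)`: the measure of the distance average with parameter `x`. -/
def Params.h {n : ℕ} (π : Params n) (A B : Set (E n)) (x : ℝ) : ℝ :=
  (volume (π.distAvg x A B)).toReal

/-- The zero-measure condition. -/
def Params.ZeroMeasure {n : ℕ} (π : Params n) (A B : Set (E n)) : Prop :=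
  volume {p | π.f A B (1 / 2) p = 0} = 0

/-- The average `t μ(A) + (1 - t) μ(B)` of the measures. -/
def measAvg {n : ℕ} (t : ℝ) (A B : Set (E n)) : ℝ :=
  t * (volume A).toReal + (1 - t) * (volume B).toReal

/-- The collection of the points of `[-N, N]` at which `|h(ξ) - (t μ(A) + (1 - t) μ(B))|` is
minimal. -/
def Params.argmins {n : ℕ} (π : Params n) (A B : Set (E n)) (t : ℝ) : Set ℝ :=
  {x | x ∈ Icc (-π.N A B) (π.N A B) ∧
    IsMinOn (fun ξ => |π.h A B ξ - measAvg t A B|) (Icc (-π.N A B) (π.N A B)) x}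

/-- The collection of the `r ≥ 0` such that the part of `A` in the (closed) `r`-offset of `B` has
measure `t μ(A) + (1 - t) μ(B)`. -/
def radii {n : ℕ} (A B : Set (E n)) (t : ℝ) : Set ℝ :=
  {r | 0 ≤ r ∧ (volume (Metric.cthickening r B ∩ A)).toReal = measAvg t A B}

/-- All arbitrary choices in the construction of the measure average: besides the parameters, a
point `g A B t` of each minimizing collection and a radius `r A B t` from each collection of
radii (whenever these collections are not empty). -/
structure Choices (n : ℕ) extends Params n where
  g : Set (E n) → Set (E n) → ℝ → ℝ
  g_spec : ∀ A B t, (toParams.argmins A B t).Nonempty → g A B t ∈ toParams.argmins A B t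
  r : Set (E n) → Set (E n) → ℝ → ℝ
  r_spec : ∀ A B t, (radii A B t).Nonempty → r A B t ∈ radii A B t

instance (n : ℕ) : Nonempty (Choices n) := by
  classical
  let π : Params n :=
    { center := fun A => if h : ∃ q, IsCenter A q then h.choose else 0
      center_spec := fun A hA hne => by
        have h := exists_isCenter hA hne
        simp only [h, dif_pos]
        exact h.choose_spec
      N := fun _ _ => 1
      one_le_N := fun _ _ => le_rfl
      eps := fun _ _ => 1
      eps_pos := fun _ _ => one_pos }
  exact ⟨{ toParams := π
           g := fun A B t => if h : (π.argmins A B t).Nonempty then h.choose else 0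
           g_spec := fun A B t h => by
             simp only [h, dif_pos]; exact h.choose_spec
           r := fun A B t => if h : (radii A B t).Nonempty then h.choose else 0
           r_spec := fun A B t h => by
             simp only [h, dif_pos]; exact h.choose_spec }⟩

open Classical in
/-- The measure average `tA ⊕ (1 - t)B` of simply different sets `B ⊆ A`. If the zero-measure
condition holds, or `t` is outside `[0, 1]`, it is `ci` of the distance average with the parameter
`g(t)`; otherwise it is `ci` of the part of `A` in the offset of `B` of radius `r(t)`. -/
def Choices.simpleAvg {n : ℕ} (c : Choices n) (t : ℝ) (A B : Set (E n)) : Set (E n) :=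
  if c.ZeroMeasure A B ∨ t ∉ Icc (0 : ℝ) 1 then ci (c.distAvg (c.g A B t) A B)
  else ci (Metric.cthickening (c.r A B t) B ∩ A)

/-- The collection of the connected components of a set. -/
def components {n : ℕ} (D : Set (E n)) : Set (Set (E n)) :=
  {C | ∃ x ∈ D, C = connectedComponentIn D x}

/-- The union of the connected components of `A \ B` of measure smaller than `ε`. -/
def Params.smallPart {n : ℕ} (π : Params n) (A B : Set (E n)) : Set (E n) :=
  ⋃₀ {C ∈ components (A \ B) | volume C < ENNReal.ofReal (π.eps A B)}

open Classical in
/-- For nested sets `B ⊂ A`, the sets that are averaged with `B`: the sets `B ∪ C` for the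
connected components `C` of `A \ B`. If there are infinitely many components, those of measure
smaller than `ε` are joined into a single one, and `ci` discards lower dimensional parts (in the
case of finitely many components `B ∪ C` is already regular compact). -/
def Params.tops {n : ℕ} (π : Params n) (A B : Set (E n)) : Set (Set (E n)) :=
  if (components (A \ B)).Finite then (fun C => B ∪ C) '' components (A \ B)
  else insert (ci (B ∪ π.smallPart A B)) ((fun C => ci (B ∪ C)) ''
    {C ∈ components (A \ B) | ENNReal.ofReal (π.eps A B) ≤ volume C})

open Classical in
/-- The measure average `tA ⊕ (1 - t)B` of nested sets `B ⊆ A`. -/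
def Choices.nestedAvg {n : ℕ} (c : Choices n) (t : ℝ) (A B : Set (E n)) : Set (E n) :=
  if A = B then A
  else if 0 ≤ t then ⋃ T ∈ c.tops A B, c.simpleAvg t T B
  else ci (⋂ T ∈ c.tops A B, c.simpleAvg t T B)

/-- `R_{1,t} = tA ⊕ (1 - t) ci(A ∩ B)`. -/
def Choices.R₁ {n : ℕ} (c : Choices n) (t : ℝ) (A B : Set (E n)) : Set (E n) :=
  c.nestedAvg t A (ci (A ∩ B))

/-- `R_{2,t} = (1 - t)B ⊕ t ci(A ∩ B)`. -/
def Choices.R₂ {n : ℕ} (c : Choices n) (t : ℝ) (A B : Set (E n)) : Set (E n) :=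
  c.nestedAvg (1 - t) B (ci (A ∩ B))

/-- The measure average `tA ⊕ (1 - t)B` for `t > 1`. -/
def Choices.extraAvg {n : ℕ} (c : Choices n) (t : ℝ) (A B : Set (E n)) : Set (E n) :=
  ci (c.R₁ t A B \ (A ∩ B)) ∪ c.R₂ t A B

open Classical in
/-- The measure average `tA ⊕ (1 - t)B` of two sets of `𝔍ₙ`, `t ∈ ℝ`. For `t < 0` it is
`(1 - t)B ⊕ tA`. -/
def Choices.avg {n : ℕ} (c : Choices n) (t : ℝ) (A B : Set (E n)) : Set (E n) :=
  if t < 0 then c.extraAvg (1 - t) B A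
  else if t ≤ 1 then c.R₁ t A B ∪ c.R₂ t A B
  else c.extraAvg t A B

/-- One refinement step of the 4-point scheme with tension parameter `w`: at even indices the sets
are kept, and the set with index `2i + 1` is `½E ⊕ ½H`, where `E = (-2w)F_{i-1} ⊕ (1+2w)F_i`
and `H = (-2w)F_{i+2} ⊕ (1+2w)F_{i+1}`. (Here `j / 2` is the floor of the half.) -/
def Choices.refine {n : ℕ} (c : Choices n) (w : ℝ) (F : ℤ → Set (E n)) (j : ℤ) : Set (E n) :=
  if j % 2 = 0 then F (j / 2)
  else c.avg (1 / 2) (c.avg (-2 * w) (F (j / 2 - 1)) (F (j / 2)))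
    (c.avg (-2 * w) (F (j / 2 + 2)) (F (j / 2 + 1)))

/-- The sets `F_i^k` of level `k` generated from the initial sets `F_i^0 = F i`. -/
def Choices.level {n : ℕ} (c : Choices n) (w : ℝ) (F : ℤ → Set (E n)) : ℕ → ℤ → Set (E n)
  | 0 => F
  | k + 1 => c.refine w (c.level w F k)

/-- `sup_i d_μ(F_i, F_{i+1})`, with values in `[0, ∞]`. -/
def supDist {n : ℕ} (F : ℤ → Set (E n)) : ℝ≥0∞ := ⨆ i : ℤ, dMu (F i) (F (i + 1))

/-- The piecewise interpolant `F_k(x)` through the sets of level `k`: it is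
`λ F_i^k ⊕ (1 - λ) F_{i+1}^k` with `λ = (i + 1) - 2^k x` for `i 2^{-k} ≤ x < (i + 1) 2^{-k}`. -/
def Choices.interp {n : ℕ} (c : Choices n) (w : ℝ) (F : ℤ → Set (E n)) (k : ℕ) (x : ℝ) :
    Set (E n) :=
  c.avg ((⌊2 ^ k * x⌋ : ℝ) + 1 - 2 ^ k * x)
    (c.level w F k ⌊2 ^ k * x⌋) (c.level w F k (⌊2 ^ k * x⌋ + 1))

end SetSubdivision

end

/-! Everything rests on two metric properties of the measure average, valid for all free choices: it
stays in `JSet`, it lies at distance at most `|t| d_μ(A, B)` from `B`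
(`Choices.avg_mem_and_dMu_right_le`), and for `t ∈ [0, 1]` at distance at most `(1 - t) d_μ(A, B)`
from `A`. Write `d` for the largest distance of neighbours. Then the extrapolated sets of the scheme
are within `2|w| d` of the old ones, so they are within `(1 + 4|w|) d` of each other. Their midpoint
average is within half of that from each, hence within `(1/2 + 4|w|) d` of both old neighbours. For
`|w| < 1/8` this is a contraction, the interpolants are uniformly Cauchy, and `LSet` is complete.

The averages are controlled through nested pairs `B ⊆ A` (`IsNestedAvg`). For a single piece, `h` is
monotone, and it is continuous except possibly at `1/2`, because the zero set of `f` is null for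
every other parameter (`Params.measure_f_eq_zero`). This is a porosity argument: towards a nearest
boundary point one of the two signed distances has slope one, and the other, with the smaller
coefficient, cannot compensate. Extrapolation only uses `h` on one side of `1/2`. Interpolation uses
all of `[0, 1]`, and where the zero-measure condition fails, offsets, whose measure is always
continuous in the radius, replace distance averages. Extrapolation may miss the target measure when
the search interval is too short, but it never overshoots, and one-sided estimates are enough.

Several pieces are handled by additivity: the bounds are linear in `μ(T \ B)`, and the sets `T \ B`
decompose `A \ B` up to null sets (`Params.isDecomposition_tops`). For general sets, the parts of
`A` and `B` outside `ci (A ∩ B)` have total measure `d_μ(A, B)`, so the two nested estimates add up.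
-/

namespace SetSubdivision

/-! ### Null level sets by porosity -/

section Porosity

variable {V : Type*} [NormedAddCommGroup V] [NormedSpace ℝ V] [FiniteDimensional ℝ V]
  [MeasurableSpace V] [BorelSpace V] (μ : Measure V) [μ.IsAddHaarMeasure]

/-- A set that contains, in arbitrarily small balls around almost all of its points, holes of
proportional size is a null set. -/
theorem measure_eq_zero_of_porous {S : Set V} (hS : MeasurableSet S)
    (h : ∀ᵐ p ∂μ, p ∈ S → ∃ δ > 0, δ ≤ 1 ∧ ∀ᶠ s in 𝓝[>] (0 : ℝ), ∃ q, dist q p ≤ s ∧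
      Disjoint (Metric.ball q (δ * s)) S) : μ S = 0 := by
  suffices ∀ᵐ p ∂μ.restrict S, False by
    rwa [ae_iff, not_false_eq_true, ofPred_true, Measure.restrict_apply_univ] at this
  have hporous := (ae_restrict_iff' hS).2 h
  filter_upwards [hporous, Besicovitch.ae_tendsto_measure_inter_div μ S] with p ⟨δ, hδ, hδ1, hp⟩ hlim
  set d := Module.finrank ℝ V
  have hhalf : Tendsto (fun s : ℝ => 2 * s) (𝓝[>] 0) (𝓝[>] 0) := by
    refine tendsto_nhdsWithin_iff.2 ⟨?_, ?_⟩
    · have : Tendsto (fun s : ℝ => 2 * s) (𝓝 0) (𝓝 (2 * 0)) := tendsto_id.const_mul 2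
      rw [mul_zero] at this
      exact this.mono_left nhdsWithin_le_nhds
    · filter_upwards [self_mem_nhdsWithin] with s hs
      have : (0 : ℝ) < s := hs
      simpa using this
  -- The hole lies in the ball of radius `2s` because `δ ≤ 1`, and fills the fraction `(δ/2)^d` of
  -- it. So the density of `S` at `p` cannot be 1, against the density theorem.
  have hle : ∀ᶠ s in 𝓝[>] (0 : ℝ), μ (S ∩ Metric.closedBall p (2 * s)) /
      μ (Metric.closedBall p (2 * s)) ≤ 1 - ENNReal.ofReal ((δ / 2) ^ d) := by
    filter_upwards [hp, self_mem_nhdsWithin] with s ⟨q, hq, hdisj⟩ hs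
    have hs : 0 < s := hs
    have hball : Metric.ball q (δ * s) ⊆ Metric.closedBall p (2 * s) := by
      intro y hy
      rw [Metric.mem_ball] at hy
      rw [Metric.mem_closedBall]
      have := dist_triangle y q p
      nlinarith
    have hpos : μ (Metric.closedBall p (2 * s)) ≠ 0 :=
      (Metric.measure_closedBall_pos μ p (by positivity)).ne'
    have hfin : μ (Metric.closedBall p (2 * s)) ≠ ⊤ := measure_closedBall_lt_top.ne
    have hvol : μ (Metric.ball q (δ * s)) =
        ENNReal.ofReal ((δ / 2) ^ d) * μ (Metric.closedBall p (2 * s)) := by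
      have h2 : δ * s = (δ / 2) * (2 * s) := by ring
      rw [Measure.addHaar_closedBall μ p (by positivity), h2,
        Measure.addHaar_ball_of_pos μ q (by positivity), mul_pow, ENNReal.ofReal_mul (by positivity),
        mul_assoc]
    rw [ENNReal.div_le_iff hpos hfin, ENNReal.sub_mul (fun _ _ => hfin), one_mul, ← hvol,
      ← measure_sdiff hball measurableSet_ball.nullMeasurableSet (measure_ball_lt_top.ne)]
    refine measure_mono fun y hy => ⟨hy.2, fun hyq => hdisj.le_bot ⟨hyq, hy.1⟩⟩
  have h1 := le_of_tendsto (hlim.comp hhalf) hle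
  have h2 : (1 : ℝ≥0∞) - ENNReal.ofReal ((δ / 2) ^ d) < 1 :=
    ENNReal.sub_lt_self ENNReal.one_ne_top one_ne_zero (by simp; positivity)
  exact absurd h1 (not_le.2 h2)

/-- A level set of a Lipschitz function is null if the function grows at a linear rate, in a
suitable direction, at almost all of its points. -/
theorem measure_level_eq_zero {f : V → ℝ} {K : ℝ} (hf : ∀ p q, |f p - f q| ≤ K * dist p q) {c : ℝ}
    (h : ∀ᵐ p ∂μ, f p = c → ∃ κ > 0, ∀ᶠ s in 𝓝[>] (0 : ℝ), ∃ q, dist q p ≤ s ∧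
      κ * s ≤ |f q - c|) : μ {p | f p = c} = 0 := by
  have hcont : Continuous f := (LipschitzWith.of_dist_le_mul (K := K.toNNReal) fun p q => by
    rw [Real.dist_eq]
    exact (hf p q).trans (by gcongr; exact Real.le_coe_toNNReal K)).continuous
  refine measure_eq_zero_of_porous μ (isClosed_eq hcont continuous_const).measurableSet ?_
  filter_upwards [h] with p hp hpc
  obtain ⟨κ, hκ, hp⟩ := hp hpc
  have hK : 0 < |K| + 1 := by positivity
  -- Within distance `κ s / (|K| + 1)` of `q` the function changes by less than `κ s`, so it cannot
  -- return to `c`; adding 1 keeps the denominator positive.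
  refine ⟨min 1 (κ / (|K| + 1)), lt_min one_pos (by positivity), min_le_left _ _, ?_⟩
  filter_upwards [hp, self_mem_nhdsWithin] with s ⟨q, hq, hqs⟩ hs
  have hs : 0 < s := hs
  refine ⟨q, hq, Set.disjoint_left.2 fun y hy hyc => ?_⟩
  rw [Metric.mem_ball] at hy
  have hyc : f y = c := hyc
  have h1 : (|K| + 1) * dist y q < κ * s := by
    have : dist y q < κ / (|K| + 1) * s :=
      hy.trans_le (mul_le_mul_of_nonneg_right (min_le_right _ _) hs.le)
    calc (|K| + 1) * dist y q < (|K| + 1) * (κ / (|K| + 1) * s) := by gcongr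
      _ = κ * s := by field_simp
  have h2 := hf q y
  rw [hyc, dist_comm] at h2
  nlinarith [le_abs_self K, dist_nonneg (x := y) (y := q)]

omit [FiniteDimensional ℝ V] [MeasurableSpace V] [BorelSpace V] in
/-- A function with Lipschitz constant one that attains slope one between two points is affine
on the segment between them. -/
theorem abs_sub_lineMap_eq {φ : V → ℝ} (hφ : ∀ p q, |φ p - φ q| ≤ dist p q) {p z : V}
    (hz : |φ z - φ p| = dist z p) (hne : z ≠ p) {s : ℝ} (hs : 0 ≤ s) (hsz : s ≤ dist z p) :
    dist (AffineMap.lineMap p z (s / dist z p)) p = s ∧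
      |φ (AffineMap.lineMap p z (s / dist z p)) - φ p| = s := by
  have hd : 0 < dist z p := dist_pos.2 hne
  set q := AffineMap.lineMap p z (s / dist z p) with hq
  have h1 : dist q p = s := by
    rw [hq, dist_lineMap_left, Real.norm_of_nonneg (by positivity), dist_comm p z]
    field_simp
  have h2 : dist q z = dist z p - s := by
    rw [hq, dist_lineMap_right, Real.norm_of_nonneg, dist_comm p z]
    · field_simp
    · rw [sub_nonneg, div_le_one hd]; exact hsz
  refine ⟨h1, le_antisymm (h1 ▸ hφ q p) ?_⟩
  have h3 := hφ q z
  have h4 : |φ z - φ p| ≤ |φ q - φ z| + |φ q - φ p| := by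
    rw [abs_sub_comm (φ q) (φ z)]
    exact abs_sub_le _ _ _
  linarith

/-- The level sets of a combination `α φ + β ψ` with `|β| < |α|` of two functions with Lipschitz
constant one are null, if `φ` attains slope one at almost all points. -/
theorem measure_level_add_eq_zero {φ ψ : V → ℝ} (hφ : ∀ p q, |φ p - φ q| ≤ dist p q)
    (hψ : ∀ p q, |ψ p - ψ q| ≤ dist p q) {α β : ℝ} (hαβ : |β| < |α|) {c : ℝ}
    (h : ∀ᵐ p ∂μ, α * φ p + β * ψ p = c → ∃ z ≠ p, |φ z - φ p| = dist z p) :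
    μ {p | α * φ p + β * ψ p = c} = 0 := by
  refine measure_level_eq_zero μ (f := fun p => α * φ p + β * ψ p) (K := |α| + |β|)
    (fun p q => ?_) ?_
  · calc |α * φ p + β * ψ p - (α * φ q + β * ψ q)|
        = |α * (φ p - φ q) + β * (ψ p - ψ q)| := by ring_nf
      _ ≤ |α| * |φ p - φ q| + |β| * |ψ p - ψ q| := by
        rw [← abs_mul, ← abs_mul]; exact abs_add_le _ _
      _ ≤ |α| * dist p q + |β| * dist p q := by
        gcongr
        · exact hφ p q
        · exact hψ p q
      _ = (|α| + |β|) * dist p q := by ring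
  · filter_upwards [h] with p hp hpc
    obtain ⟨z, hzp, hz⟩ := hp hpc
    -- Towards `z` the term `α φ` changes by exactly `|α| s`, and `β ψ` offsets at most `|β| s` of
    -- it.
    refine ⟨|α| - |β|, sub_pos.2 hαβ, ?_⟩
    have hd : 0 < dist z p := dist_pos.2 hzp
    filter_upwards [Ioc_mem_nhdsGT hd] with s hs
    obtain ⟨h1, h2⟩ := abs_sub_lineMap_eq hφ hz hzp hs.1.le hs.2
    refine ⟨_, h1.le, ?_⟩
    generalize AffineMap.lineMap p z (s / dist z p) = q at h1 h2
    have h3 := hψ q p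
    rw [h1] at h3
    have h4 : |α| * s ≤ |α * φ q + β * ψ q - c| + |β| * s := by
      calc |α| * s = |(α * φ q + β * ψ q - c) - β * (ψ q - ψ p)| := by
            rw [← hpc, ← h2, ← abs_mul]; ring_nf
        _ ≤ |α * φ q + β * ψ q - c| + |β * (ψ q - ψ p)| := abs_sub _ _
        _ ≤ _ := by rw [abs_mul]; gcongr
    linarith

end Porosity

/-! ### Regular compact Jordan measurable sets -/

section Regular

variable {n : ℕ}

theorem ci_subset_closure (S : Set (E n)) : ci S ⊆ closure S := closure_mono interior_subset

theorem interior_subset_ci (S : Set (E n)) : interior S ⊆ ci S := subset_closure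

theorem isClosed_ci (S : Set (E n)) : IsClosed (ci S) := isClosed_closure

theorem ci_mono {S T : Set (E n)} (h : S ⊆ T) : ci S ⊆ ci T := closure_mono (interior_mono h)

theorem ci_subset {S K : Set (E n)} (hK : IsClosed K) (h : S ⊆ K) : ci S ⊆ K :=
  (ci_subset_closure S).trans (closure_minimal h hK)

theorem ci_ci (S : Set (E n)) : ci (ci S) = ci S := by
  refine Subset.antisymm (ci_subset (isClosed_ci S) Subset.rfl) ?_
  exact closure_mono (interior_maximal subset_closure isOpen_interior)

theorem ci_ae_eq {S : Set (E n)} (h : volume (frontier S) = 0) : ci S =ᵐ[volume] S := by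
  refine Filter.EventuallyLE.antisymm ?_ ?_
  · refine ((ci_subset_closure S).eventuallyLE).trans ?_
    rw [ae_le_set]
    exact measure_mono_null (show closure S \ S ⊆ frontier S from fun x hx =>
      ⟨hx.1, fun hxi => hx.2 (interior_subset hxi)⟩) h
  · rw [ae_le_set]
    exact measure_mono_null (show S \ ci S ⊆ frontier S from fun x hx =>
      ⟨subset_closure hx.1, fun hxi => hx.2 (interior_subset_ci S hxi)⟩) h

theorem ci_mem_JSet {S : Set (E n)} (hb : Bornology.IsBounded S) (h : volume (frontier S) = 0) :
    ci S ∈ JSet n :=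
  ⟨hb.closure.subset (ci_subset_closure S), (ci_ci S).symm,
    measure_mono_null (frontier_closure_subset.trans frontier_interior_subset) h⟩

namespace JSet

variable {A B : Set (E n)}

theorem measurableSet (hA : A ∈ JSet n) : MeasurableSet A := (JSet.isClosed hA).measurableSet

theorem ne_top (hA : A ∈ JSet n) : volume A ≠ ⊤ := hA.1.measure_lt_top.ne

/-- An open null set is empty, and `A` is the closure of its interior. This upgrades almost
everywhere comparisons to genuine inclusions. -/
theorem subset_of_ae_le (hA : A ∈ JSet n) {K : Set (E n)} (hK : IsClosed K)
    (h : A ≤ᵐ[volume] K) : A ⊆ K := by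
  have hopen : IsOpen (interior A \ K) := isOpen_interior.sdiff hK
  have hnull : volume (interior A \ K) = 0 :=
    measure_mono_null (sdiff_subset_sdiff_left interior_subset) (ae_le_set.1 h)
  have hempty := hopen.measure_eq_zero_iff volume |>.1 hnull
  rw [hA.2.1]
  exact closure_minimal (sdiff_eq_empty.1 hempty) hK

/-- Serves for closed sets whose own frontier is not known to be null. -/
theorem ci_eq_of_ae_eq (hA : A ∈ JSet n) {K : Set (E n)} (hK : IsClosed K)
    (h : K =ᵐ[volume] A) : ci K = A := by
  refine Subset.antisymm ?_ ?_
  · have hopen : IsOpen (interior K \ A) := isOpen_interior.sdiff (JSet.isClosed hA)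
    have hnull : volume (interior K \ A) = 0 :=
      measure_mono_null (sdiff_subset_sdiff_left interior_subset) (ae_le_set.1 h.le)
    exact closure_minimal (sdiff_eq_empty.1 (hopen.measure_eq_zero_iff volume |>.1 hnull))
      (JSet.isClosed hA)
  · have := ci_mono (subset_of_ae_le hA hK h.symm.le)
    rwa [← hA.2.1] at this

theorem union (hA : A ∈ JSet n) (hB : B ∈ JSet n) : A ∪ B ∈ JSet n := by
  have hcl : IsClosed (A ∪ B) := (JSet.isClosed hA).union (JSet.isClosed hB)
  refine ⟨hA.1.union hB.1, Subset.antisymm (union_subset ?_ ?_) (ci_subset hcl Subset.rfl), ?_⟩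
  · conv_lhs => rw [hA.2.1]
    exact ci_mono subset_union_left
  · conv_lhs => rw [hB.2.1]
    exact ci_mono subset_union_right
  · refine measure_mono_null ((frontier_union_subset A B).trans
      (union_subset_union inter_subset_left inter_subset_right)) (measure_union_null hA.2.2 hB.2.2)

theorem empty : (∅ : Set (E n)) ∈ JSet n := by simp [JSet, ci]

theorem biUnion {ι : Type*} {s : Set ι} (hs : s.Finite) {R : ι → Set (E n)}
    (hR : ∀ i ∈ s, R i ∈ JSet n) : ⋃ i ∈ s, R i ∈ JSet n := by
  induction s, hs using Set.Finite.induction_on with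
  | empty => simpa using JSet.empty
  | insert _ _ ih =>
    rw [biUnion_insert]
    exact JSet.union (hR _ (mem_insert _ _)) (ih fun i hi => hR i (mem_insert_of_mem _ hi))

end JSet

theorem measure_frontier_inter_eq_zero {S T : Set (E n)} (hS : volume (frontier S) = 0)
    (hT : volume (frontier T) = 0) : volume (frontier (S ∩ T)) = 0 :=
  measure_mono_null ((frontier_inter_subset S T).trans
    (union_subset_union inter_subset_left inter_subset_right)) (measure_union_null hS hT)

theorem measure_frontier_diff_eq_zero {S T : Set (E n)} (hS : volume (frontier S) = 0)
    (hT : volume (frontier T) = 0) : volume (frontier (S \ T)) = 0 := by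
  rw [sdiff_eq]
  exact measure_frontier_inter_eq_zero hS (by rwa [frontier_compl])

theorem measure_frontier_biInter_eq_zero {ι : Type*} {s : Set ι} (hs : s.Finite)
    {R : ι → Set (E n)} (hR : ∀ i ∈ s, volume (frontier (R i)) = 0) :
    volume (frontier (⋂ i ∈ s, R i)) = 0 := by
  induction s, hs using Set.Finite.induction_on with
  | empty => simp
  | insert _ _ ih =>
    rw [biInter_insert]
    exact measure_frontier_inter_eq_zero (hR _ (mem_insert _ _))
      (ih fun i hi => hR i (mem_insert_of_mem _ hi))

end Regular

/-- Otherwise `interior A` and the complement of `closure A` would disconnect `s`. -/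
theorem _root_.IsPreconnected.inter_frontier_nonempty_of_mem {X : Type*} [TopologicalSpace X]
    {s A : Set X} (hs : IsPreconnected s) {p q : X} (hp : p ∈ s) (hq : q ∈ s) (hpA : p ∈ A)
    (hqA : q ∉ A) : (s ∩ frontier A).Nonempty := by
  by_contra hne
  rw [not_nonempty_iff_eq_empty, ← disjoint_iff_inter_eq_empty, Set.disjoint_left] at hne
  have hcover : s ⊆ interior A ∪ (closure A)ᶜ := fun x hx => by
    have := hne hx
    rw [frontier, Set.mem_sdiff] at this
    by_cases hxi : x ∈ interior A
    · exact Or.inl hxi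
    · exact Or.inr fun hxc => this ⟨hxc, hxi⟩
  obtain ⟨x, -, hx1, hx2⟩ := hs _ _ isOpen_interior isClosed_closure.isOpen_compl hcover
    ⟨p, hp, (hcover hp).resolve_right fun h => h (subset_closure hpA)⟩
    ⟨q, hq, (hcover hq).resolve_left fun h => hqA (interior_subset h)⟩
  exact hx2 (interior_subset_closure hx1)

/-! ### Signed distances -/

section SignedDist

variable {n : ℕ} {A B : Set (E n)} {p q : E n}

theorem signedDist_of_mem (h : p ∈ A) : signedDist p A = Metric.infDist p (frontier A) := if_pos h

theorem signedDist_of_notMem (h : p ∉ A) : signedDist p A = -Metric.infDist p (frontier A) :=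
  if_neg h

theorem signedDist_nonneg (h : p ∈ A) : 0 ≤ signedDist p A := by
  rw [signedDist_of_mem h]; exact Metric.infDist_nonneg

theorem signedDist_nonpos (h : p ∉ interior A) : signedDist p A ≤ 0 := by
  by_cases hp : p ∈ A
  · rw [signedDist_of_mem hp, Metric.infDist_zero_of_mem (show p ∈ frontier A from ⟨subset_closure hp, h⟩)]
  · rw [signedDist_of_notMem hp]
    exact neg_nonpos.2 Metric.infDist_nonneg

theorem abs_signedDist : |signedDist p A| = Metric.infDist p (frontier A) := by
  unfold signedDist
  split_ifs
  · exact abs_of_nonneg Metric.infDist_nonneg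
  · rw [abs_neg]; exact abs_of_nonneg Metric.infDist_nonneg

theorem signedDist_of_mem_frontier (h : p ∈ frontier A) : signedDist p A = 0 := by
  rw [← abs_eq_zero, abs_signedDist, Metric.infDist_zero_of_mem h]

theorem exists_abs_signedDist_eq_dist (hA : (frontier A).Nonempty) (p : E n) :
    ∃ z ∈ frontier A, |signedDist p A| = dist p z := by
  rw [abs_signedDist]
  exact isClosed_frontier.exists_infDist_eq_dist hA p

theorem signedDist_eq_zero_iff (hA : (frontier A).Nonempty) :
    signedDist p A = 0 ↔ p ∈ frontier A := by
  refine ⟨fun h => ?_, signedDist_of_mem_frontier⟩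
  obtain ⟨z, hz, hd⟩ := exists_abs_signedDist_eq_dist hA p
  rw [h, abs_zero] at hd
  rwa [dist_eq_zero.1 hd.symm]

theorem signedDist_nonneg_iff (hcl : IsClosed A) (hA : (frontier A).Nonempty) :
    0 ≤ signedDist p A ↔ p ∈ A := by
  refine ⟨fun h => ?_, signedDist_nonneg⟩
  by_contra hp
  rw [signedDist_of_notMem hp] at h
  have h0 : signedDist p A = 0 := by
    rw [signedDist_of_notMem hp, neg_eq_zero]
    exact le_antisymm (neg_nonneg.1 h) Metric.infDist_nonneg
  exact hp (hcl.frontier_subset ((signedDist_eq_zero_iff hA).1 h0))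

/-- In the one critical case, `p` inside and `q` outside, the segment between them crosses the
frontier, and the crossing point splits `dist p q` into bounds for the two distances. -/
theorem signedDist_sub_le (p q : E n) (A : Set (E n)) :
    signedDist p A - signedDist q A ≤ dist p q := by
  by_cases hp : p ∈ A <;> by_cases hq : q ∈ A
  · rw [signedDist_of_mem hp, signedDist_of_mem hq, sub_le_iff_le_add, add_comm]
    exact Metric.infDist_le_infDist_add_dist
  · rw [signedDist_of_mem hp, signedDist_of_notMem hq, sub_neg_eq_add]
    obtain ⟨z, hz, hzA⟩ := (convex_segment p q).isPreconnected.inter_frontier_nonempty_of_mem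
      (left_mem_segment ℝ p q) (right_mem_segment ℝ p q) hp hq
    rw [← dist_add_dist_of_mem_segment hz, dist_comm z q]
    exact add_le_add (Metric.infDist_le_dist_of_mem hzA) (Metric.infDist_le_dist_of_mem hzA)
  · rw [signedDist_of_notMem hp, signedDist_of_mem hq]
    have h1 : 0 ≤ Metric.infDist p (frontier A) := Metric.infDist_nonneg
    have h2 : 0 ≤ Metric.infDist q (frontier A) := Metric.infDist_nonneg
    linarith [dist_nonneg (x := p) (y := q)]
  · rw [signedDist_of_notMem hp, signedDist_of_notMem hq, neg_sub_neg, sub_le_iff_le_add, add_comm,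
      dist_comm]
    exact Metric.infDist_le_infDist_add_dist

theorem abs_signedDist_sub_le (A : Set (E n)) (p q : E n) :
    |signedDist p A - signedDist q A| ≤ dist p q := by
  refine abs_le.2 ⟨?_, signedDist_sub_le p q A⟩
  have := signedDist_sub_le q p A
  rw [dist_comm] at this
  linarith

/-- A frontier point of `A` is not interior to `B`, and a frontier point of `B` lies in `A`.
Comparing with the nearest such point and using the Lipschitz bound settles both cases. -/
theorem signedDist_mono (hBA : B ⊆ A) (hB : IsClosed B) (hA : (frontier A).Nonempty)
    (hBf : (frontier B).Nonempty) (p : E n) : signedDist p B ≤ signedDist p A := by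
  by_cases hp : p ∈ A
  · obtain ⟨z, hz, hd⟩ := exists_abs_signedDist_eq_dist hA p
    rw [abs_of_nonneg (signedDist_nonneg hp)] at hd
    have h1 : signedDist z B ≤ 0 := signedDist_nonpos fun h => hz.2 (interior_mono hBA h)
    linarith [signedDist_sub_le p z B]
  · obtain ⟨z, hz, hd⟩ := exists_abs_signedDist_eq_dist hBf p
    have hpB : p ∉ interior B := fun h => hp (hBA (interior_subset h))
    rw [abs_of_nonpos (signedDist_nonpos hpB)] at hd
    have h1 : 0 ≤ signedDist z A := signedDist_nonneg (hBA (hB.frontier_subset hz))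
    have := signedDist_sub_le z p A
    rw [dist_comm] at this
    linarith

theorem exists_slope_signedDist (hA : (frontier A).Nonempty) (hp : p ∉ frontier A) :
    ∃ z ≠ p, |signedDist z A - signedDist p A| = dist z p := by
  obtain ⟨z, hz, hd⟩ := exists_abs_signedDist_eq_dist hA p
  refine ⟨z, fun h => hp (h ▸ hz), ?_⟩
  rw [signedDist_of_mem_frontier hz, zero_sub, abs_neg, hd, dist_comm]

theorem JSet.frontier_nonempty [Nontrivial (E n)] (hA : A ∈ JSet n) (hne : A.Nonempty) :
    (frontier A).Nonempty :=
  nonempty_frontier_iff.2 ⟨hne, (JSet.isCompact hA).ne_univ⟩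

end SignedDist

/-! ### Operands of the distance average and their zero sets -/

section Operand

variable {n : ℕ} (π : Params n) {A B : Set (E n)}

theorem Params.operandDist_empty (B : Set (E n)) (p : E n) :
    π.operandDist ∅ B p = -‖p - π.center B‖ := if_pos rfl

theorem Params.operandDist_of_nonempty (hA : A.Nonempty) (B : Set (E n)) (p : E n) :
    π.operandDist A B p = signedDist p A := if_neg hA.ne_empty

theorem Params.abs_operandDist_sub_le (A B : Set (E n)) (p q : E n) :
    |π.operandDist A B p - π.operandDist A B q| ≤ dist p q := by
  rcases A.eq_empty_or_nonempty with rfl | hA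
  · rw [π.operandDist_empty, π.operandDist_empty, neg_sub_neg, abs_sub_comm, dist_eq_norm]
    simpa using abs_norm_sub_norm_le (p - π.center B) (q - π.center B)
  · rw [π.operandDist_of_nonempty hA, π.operandDist_of_nonempty hA]
    exact abs_signedDist_sub_le A p q

theorem Params.continuous_operandDist (A B : Set (E n)) : Continuous (π.operandDist A B) :=
  (LipschitzWith.of_dist_le_mul (K := 1) fun p q => by
    simpa [Real.dist_eq] using π.abs_operandDist_sub_le A B p q).continuous

theorem Params.continuous_f (A B : Set (E n)) (x : ℝ) : Continuous (π.f A B x) :=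
  ((π.continuous_operandDist A B).const_mul x).add
    ((π.continuous_operandDist B A).const_mul (1 - x))

theorem Params.continuous_f_param (A B : Set (E n)) (p : E n) : Continuous fun x => π.f A B x p := by
  unfold Params.f; fun_prop

variable [Nontrivial (E n)]

theorem ae_ne (q : E n) : ∀ᵐ p : E n, p ≠ q := by
  have : volume ({q} : Set (E n)) = 0 := measure_singleton q
  exact measure_eq_zero_iff_ae_notMem.1 this

/-- The direction is towards a nearest frontier point, or towards the center if the set is empty;
only the frontier or the center itself must be excluded. -/
theorem Params.ae_exists_slope (hA : A ∈ JSet n) (B : Set (E n)) :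
    ∀ᵐ p, ∃ z ≠ p, |π.operandDist A B z - π.operandDist A B p| = dist z p := by
  rcases A.eq_empty_or_nonempty with rfl | hne
  · filter_upwards [ae_ne (π.center B)] with p hp
    refine ⟨π.center B, hp.symm, ?_⟩
    simp [π.operandDist_empty, dist_eq_norm, norm_sub_rev]
  · filter_upwards [measure_eq_zero_iff_ae_notMem.1 hA.2.2] with p hp
    simpa only [π.operandDist_of_nonempty hne] using
      exists_slope_signedDist (JSet.frontier_nonempty hA hne) hp

/-- The zero set of `f` is null unless the parameter is `1/2`. -/
theorem Params.measure_f_eq_zero (hA : A ∈ JSet n) (hB : B ∈ JSet n) {x : ℝ} (hx : x ≠ 1 / 2) :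
    volume {p | π.f A B x p = 0} = 0 := by
  rcases hx.lt_or_gt with h | h
  · have habs : |x| < |1 - x| := by
      rw [abs_lt, abs_of_pos (by linarith)]; constructor <;> linarith
    have := measure_level_add_eq_zero volume (c := 0) (π.abs_operandDist_sub_le B A)
      (π.abs_operandDist_sub_le A B) habs
      ((π.ae_exists_slope hB A).mono fun p hp _ => hp)
    simpa only [Params.f, add_comm] using this
  · have habs : |1 - x| < |x| := by
      rw [abs_lt, abs_of_pos (by linarith)]; constructor <;> linarith
    exact measure_level_add_eq_zero volume (c := 0) (π.abs_operandDist_sub_le A B)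
      (π.abs_operandDist_sub_le B A) habs
      ((π.ae_exists_slope hA B).mono fun p hp _ => hp)

theorem exists_pos_signedDist (hA : A ∈ JSet n) (hne : A.Nonempty) : ∃ a ∈ A, 0 < signedDist a A := by
  have hint : (interior A).Nonempty := by
    rw [hA.2.1, ci] at hne
    exact closure_nonempty_iff.1 hne
  obtain ⟨a, ha⟩ := hint
  refine ⟨a, interior_subset ha, (signedDist_nonneg (interior_subset ha)).lt_of_ne fun h => ?_⟩
  exact ((signedDist_eq_zero_iff (JSet.frontier_nonempty hA hne)).1 h.symm).2 ha

/-- Averages with the empty set satisfy the zero-measure condition, since the centers lie off the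
boundary. -/
theorem Params.zeroMeasure_empty (hA : A ∈ JSet n) (hne : A.Nonempty) : π.ZeroMeasure A ∅ := by
  set q := π.center A
  have hq := π.center_spec A hA hne
  have hf : ∀ p, π.f A ∅ (1 / 2) p = 0 ↔ signedDist p A - ‖p - q‖ = 0 := fun p => by
    rw [Params.f, π.operandDist_of_nonempty hne, π.operandDist_empty]
    constructor <;> intro h <;> linarith
  have hfr := JSet.frontier_nonempty hA hne
  have hqf : q ∉ frontier A := fun h => by
    obtain ⟨a, ha, hpos⟩ := exists_pos_signedDist hA hne
    have h1 := hq.2 a ha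
    rw [signedDist_of_mem_frontier (show π.center A ∈ frontier A from h)] at h1
    exact absurd hpos (not_lt.2 h1)
  unfold Params.ZeroMeasure
  simp only [hf]
  refine measure_level_eq_zero volume (K := 2) (fun p p' => ?_) ?_
  · have h1 := abs_signedDist_sub_le A p p'
    have h2 : |‖p - q‖ - ‖p' - q‖| ≤ dist p p' := by
      rw [dist_eq_norm]
      simpa using abs_norm_sub_norm_le (p - q) (p' - q)
    rw [abs_le] at h1 h2 ⊢
    constructor <;> linarith
  · filter_upwards [measure_eq_zero_iff_ae_notMem.1 hA.2.2, ae_ne q] with p hp hpq hpz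
    have hρ : signedDist p A = ‖p - q‖ := sub_eq_zero.1 hpz
    have hρ0 : 0 < ‖p - q‖ := norm_pos_iff.2 (sub_ne_zero.2 hpq)
    obtain ⟨z, hz, hd⟩ := exists_abs_signedDist_eq_dist hfr p
    rw [hρ, abs_of_pos hρ0, dist_eq_norm] at hd
    set ρ := ‖p - q‖ with hρdef
    -- Both coefficients are equal here, so slopes alone do not decide. But the nearest frontier
    -- point `z` and the center `q`, both at distance `ρ` from `p`, lie in different directions:
    -- moving towards `z` lowers the signed distance at rate at least 1 and the distance to `q` at
    -- rate at most `⟨u, v⟩ < 1`.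
    obtain ⟨u, hu⟩ : ∃ u, u = ρ⁻¹ • (p - z) := ⟨_, rfl⟩
    obtain ⟨v, hv⟩ : ∃ v, v = ρ⁻¹ • (p - q) := ⟨_, rfl⟩
    have hu1 : ‖u‖ = 1 := by
      rw [hu, norm_smul, ← hd, norm_inv, Real.norm_of_nonneg hρ0.le, inv_mul_cancel₀ hρ0.ne']
    have hv1 : ‖v‖ = 1 := by
      rw [hv, norm_smul, ← hρdef, norm_inv, Real.norm_of_nonneg hρ0.le, inv_mul_cancel₀ hρ0.ne']
    have huv : u ≠ v := fun h => by
      have h1 : p - z = p - q := smul_right_injective _ (inv_ne_zero hρ0.ne') (hu.symm.trans (h.trans hv))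
      exact hqf (sub_right_injective h1 ▸ hz)
    have hlt : inner ℝ u v < 1 := (inner_lt_one_iff_real_of_norm_eq_one hu1 hv1).2 huv
    refine ⟨1 - inner ℝ u v, sub_pos.2 hlt, ?_⟩
    filter_upwards [Ioc_mem_nhdsGT hρ0] with s hs
    refine ⟨p - s • u, ?_, ?_⟩
    · rw [dist_eq_norm, sub_sub_cancel_left, norm_neg, norm_smul, hu1, mul_one,
        Real.norm_of_nonneg hs.1.le]
    · have h1 : signedDist (p - s • u) A ≤ ρ - s := by
        have h2 := signedDist_sub_le (p - s • u) z A
        rw [signedDist_of_mem_frontier hz, dist_eq_norm] at h2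
        have h3 : p - s • u - z = (1 - s / ρ) • (p - z) := by
          rw [hu, smul_smul, sub_smul, one_smul, div_eq_mul_inv]; abel
        rw [h3, norm_smul, ← hd, Real.norm_of_nonneg] at h2
        · have h4 : (1 - s / ρ) * ρ = ρ - s := by field_simp
          linarith
        · rw [sub_nonneg, div_le_one hρ0]; exact hs.2
      have h2 : ρ - s * inner ℝ u v ≤ ‖p - s • u - q‖ := by
        have h3 : inner ℝ (p - s • u - q) v ≤ ‖p - s • u - q‖ * ‖v‖ := real_inner_le_norm _ _
        have h4 : p - s • u - q = ρ • v - s • u := by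
          rw [hv, smul_inv_smul₀ hρ0.ne']; abel
        rw [hv1, mul_one] at h3
        refine le_trans (le_of_eq ?_) h3
        rw [h4, inner_sub_left, real_inner_smul_left, real_inner_smul_left,
          real_inner_self_eq_norm_sq, hv1]
        ring
      rw [sub_zero, abs_sub_comm]
      refine le_trans ?_ (le_abs_self _)
      linarith

end Operand

/-! ### Monotonicity and continuity of the distance average -/

section DistAvg

variable {n : ℕ} [Nontrivial (E n)] (π : Params n) {A B : Set (E n)}

theorem Params.operandDist_mono (hA : A ∈ JSet n) (hB : B ∈ JSet n) (hBA : B ⊆ A)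
    (hne : A.Nonempty) (p : E n) : π.operandDist B A p ≤ π.operandDist A B p := by
  rw [π.operandDist_of_nonempty hne]
  rcases B.eq_empty_or_nonempty with rfl | hBne
  · rw [π.operandDist_empty]
    have h1 := signedDist_nonneg (π.center_spec A hA hne).1
    have h2 := signedDist_sub_le (π.center A) p A
    rw [dist_comm, dist_eq_norm] at h2
    linarith
  · rw [π.operandDist_of_nonempty hBne]
    exact signedDist_mono hBA (JSet.isClosed hB) (JSet.frontier_nonempty hA hne)
      (JSet.frontier_nonempty hB hBne) p

omit [Nontrivial (E n)] in
theorem Params.f_eq (A B : Set (E n)) (x : ℝ) (p : E n) :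
    π.f A B x p = π.operandDist B A p + x * (π.operandDist A B p - π.operandDist B A p) := by
  rw [Params.f]; ring

omit [Nontrivial (E n)] in
theorem Params.distAvg_eq (hne : A.Nonempty) (B : Set (E n)) (x : ℝ) :
    π.distAvg x A B = {p | 0 ≤ π.f A B x p} := if_neg fun h => hne.ne_empty h.1

omit [Nontrivial (E n)] in
theorem Params.isClosed_distAvg (hne : A.Nonempty) (B : Set (E n)) (x : ℝ) :
    IsClosed (π.distAvg x A B) := by
  rw [π.distAvg_eq hne]
  exact isClosed_le continuous_const (π.continuous_f A B x)

omit [Nontrivial (E n)] in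
theorem Params.frontier_distAvg_subset (hne : A.Nonempty) (B : Set (E n)) (x : ℝ) :
    frontier (π.distAvg x A B) ⊆ {p | π.f A B x p = 0} := by
  rw [π.distAvg_eq hne]
  intro p hp
  exact (frontier_le_subset_eq continuous_const (π.continuous_f A B x) hp).symm

theorem Params.distAvg_mono (hA : A ∈ JSet n) (hB : B ∈ JSet n) (hBA : B ⊆ A) (hne : A.Nonempty) :
    Monotone fun x => π.distAvg x A B := by
  intro x y hxy p hp
  simp only [π.distAvg_eq hne, mem_ofPred_eq, π.f_eq] at hp ⊢
  have := π.operandDist_mono hA hB hBA hne p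
  nlinarith

theorem Params.distAvg_one (hA : A ∈ JSet n) (hne : A.Nonempty) : π.distAvg 1 A B = A := by
  ext p
  simp [π.distAvg_eq hne, Params.f, π.operandDist_of_nonempty hne,
    signedDist_nonneg_iff (JSet.isClosed hA) (JSet.frontier_nonempty hA hne)]

/-- Equality can fail only for empty `B`, where the distance average contains the center of `A`. -/
theorem Params.distAvg_zero_ae_eq (hB : B ∈ JSet n) (hne : A.Nonempty) :
    π.distAvg 0 A B =ᵐ[volume] B := by
  rcases B.eq_empty_or_nonempty with rfl | hBne
  · rw [ae_eq_empty]
    refine measure_mono_null (t := {π.center A}) (fun p hp => ?_) (measure_singleton _)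
    rw [π.distAvg_eq hne] at hp
    have hp : 0 ≤ π.f A ∅ 0 p := hp
    simp only [Params.f, π.operandDist_empty, zero_mul, sub_zero, one_mul, zero_add] at hp
    exact sub_eq_zero.1 (norm_le_zero_iff.1 (neg_nonneg.1 hp))
  · refine Eventually.of_forall fun p => propext ?_
    change p ∈ π.distAvg 0 A B ↔ p ∈ B
    simp [π.distAvg_eq hne, Params.f, π.operandDist_of_nonempty hBne,
      signedDist_nonneg_iff (JSet.isClosed hB) (JSet.frontier_nonempty hB hBne)]

theorem exists_signedDist_le (hA : A ∈ JSet n) (hne : A.Nonempty) (q : E n) :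
    ∃ R, ∀ p, signedDist p A ≤ R - dist p q := by
  obtain ⟨R, hR⟩ := hA.1.subset_closedBall q
  -- Inside `A` the signed distance is at most `2R` while `dist p q ≤ R`; outside, `R` would do.
  refine ⟨3 * R, fun p => ?_⟩
  obtain ⟨z, hz, hd⟩ := exists_abs_signedDist_eq_dist (JSet.frontier_nonempty hA hne) p
  have hzq : dist z q ≤ R := hR ((JSet.isClosed hA).frontier_subset hz)
  have hR0 : 0 ≤ R := dist_nonneg.trans hzq
  by_cases hp : p ∈ A
  · have hpq : dist p q ≤ R := hR hp
    have := dist_triangle_right p z q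
    linarith [le_abs_self (signedDist p A)]
  · have h1 : signedDist p A ≤ 0 := signedDist_nonpos fun h => hp (interior_subset h)
    rw [abs_of_nonpos h1] at hd
    linarith [dist_triangle p z q]

omit [Nontrivial (E n)] in
theorem exists_operandDist_ge (A B : Set (E n)) :
    ∃ q, ∀ p, -dist p q ≤ π.operandDist B A p := by
  rcases B.eq_empty_or_nonempty with rfl | ⟨q, hq⟩
  · refine ⟨π.center A, fun p => ?_⟩
    rw [π.operandDist_empty, dist_eq_norm]
  · refine ⟨q, fun p => ?_⟩
    rw [π.operandDist_of_nonempty ⟨q, hq⟩]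
    have h1 := signedDist_nonneg hq
    have h2 := signedDist_sub_le q p B
    rw [dist_comm] at h2
    linarith

/-- Distance averages with parameters in a bounded interval are uniformly bounded. -/
theorem Params.exists_distAvg_subset (hA : A ∈ JSet n) (hB : B ∈ JSet n) (hBA : B ⊆ A)
    (hne : A.Nonempty) (M : ℝ) :
    ∃ (q : E n) (R : ℝ), ∀ x, x ≤ M → π.distAvg x A B ⊆ Metric.closedBall q R := by
  obtain ⟨q, hq⟩ := exists_operandDist_ge π A B
  obtain ⟨R, hR⟩ := exists_signedDist_le hA hne q
  -- The smaller operand is at most `R - dist p q`, and the two operands differ by at most `R`, so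
  -- `f` is at most `R - dist p q + x R`.
  have key : ∀ x, 0 ≤ x → π.distAvg x A B ⊆ Metric.closedBall q (R + x * R) := fun x hx p hp => by
    rw [π.distAvg_eq hne] at hp
    have hp : 0 ≤ π.f A B x p := hp
    rw [π.f_eq] at hp
    have h1 := hq p
    have h2 := hR p
    rw [← π.operandDist_of_nonempty hne B] at h2
    have h3 := π.operandDist_mono hA hB hBA hne p
    rw [Metric.mem_closedBall]
    nlinarith
  refine ⟨q, R + |M| * R, fun x hx => ?_⟩
  exact (π.distAvg_mono hA hB hBA hne (hx.trans (le_abs_self M))).trans (key _ (abs_nonneg M))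

theorem Params.isBounded_distAvg (hA : A ∈ JSet n) (hB : B ∈ JSet n) (hBA : B ⊆ A)
    (hne : A.Nonempty) (x : ℝ) : Bornology.IsBounded (π.distAvg x A B) := by
  obtain ⟨q, R, h⟩ := π.exists_distAvg_subset hA hB hBA hne x
  exact Metric.isBounded_closedBall.subset (h x le_rfl)

theorem Params.h_mono (hA : A ∈ JSet n) (hB : B ∈ JSet n) (hBA : B ⊆ A) (hne : A.Nonempty) :
    Monotone (π.h A B) := fun _ y hxy =>
  ENNReal.toReal_mono (π.isBounded_distAvg hA hB hBA hne y).measure_lt_top.ne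
    (measure_mono (π.distAvg_mono hA hB hBA hne hxy))

theorem Params.h_one (hA : A ∈ JSet n) (hne : A.Nonempty) : π.h A B 1 = volume.real A := by
  rw [Params.h, π.distAvg_one hA hne]; rfl

theorem Params.h_zero (hB : B ∈ JSet n) (hne : A.Nonempty) : π.h A B 0 = volume.real B := by
  rw [Params.h, measure_congr (π.distAvg_zero_ae_eq hB hne)]; rfl

/-- The distance averages form a chain, so their measures alone decide inclusion up to null sets.
This is why the choice among minimizers is immaterial. -/
theorem Params.distAvg_ae_le (hA : A ∈ JSet n) (hB : B ∈ JSet n) (hBA : B ⊆ A) (hne : A.Nonempty)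
    {x y : ℝ} (hxy : π.h A B x ≤ π.h A B y) : π.distAvg x A B ≤ᵐ[volume] π.distAvg y A B := by
  have hfin : ∀ x, volume (π.distAvg x A B) ≠ ⊤ := fun x =>
    (π.isBounded_distAvg hA hB hBA hne x).measure_lt_top.ne
  rcases le_total x y with h | h
  · exact (π.distAvg_mono hA hB hBA hne h).eventuallyLE
  · exact (ae_eq_of_subset_of_measure_ge (π.distAvg_mono hA hB hBA hne h)
      ((ENNReal.toReal_le_toReal (hfin x) (hfin y)).1 hxy)
      (π.isClosed_distAvg hne B y).measurableSet.nullMeasurableSet (hfin x)).symm.le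

/-- Off the zero set of `f`, membership is locally constant in the parameter; the uniform bound
supplies the domination. -/
theorem Params.continuousAt_h (hA : A ∈ JSet n) (hB : B ∈ JSet n) (hBA : B ⊆ A) (hne : A.Nonempty)
    {x : ℝ} (hx : volume {p | π.f A B x p = 0} = 0) : ContinuousAt (π.h A B) x := by
  obtain ⟨q, R, hR⟩ := π.exists_distAvg_subset hA hB hBA hne (x + 1)
  refine (ENNReal.tendsto_toReal (π.isBounded_distAvg hA hB hBA hne x).measure_lt_top.ne).comp ?_
  refine tendsto_measure_of_ae_tendsto_indicator (𝓝 x)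
    (π.isClosed_distAvg hne B x).measurableSet
    (fun y => (π.isClosed_distAvg hne B y).measurableSet)
    (measurableSet_closedBall (x := q) (ε := R)) measure_closedBall_lt_top.ne ?_ ?_
  · filter_upwards [Iic_mem_nhds (lt_add_one x)] with y hy using hR y hy
  · filter_upwards [measure_eq_zero_iff_ae_notMem.1 hx] with p hp
    have hcont := (π.continuous_f_param A B p).continuousAt (x := x)
    simp only [π.distAvg_eq hne, mem_ofPred_eq]
    rcases lt_or_gt_of_ne hp with h | h
    · filter_upwards [hcont.eventually_lt_const h] with y hy
      exact iff_of_false (not_le.2 hy) (not_le.2 h)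
    · filter_upwards [hcont.eventually_const_lt h] with y hy
      exact iff_of_true hy.le h.le

end DistAvg

/-! ### Minimizers for a monotone function -/

section Argmin

theorem eq_of_isMinOn_abs_sub {h : ℝ → ℝ} {s : Set ℝ} {m g ξ : ℝ}
    (hg : IsMinOn (fun x => |h x - m|) s g) (hξ : ξ ∈ s) (hm : h ξ = m) : h g = m := by
  have : |h g - m| ≤ |h ξ - m| := hg hξ
  rw [hm, sub_self, abs_zero] at this
  exact sub_eq_zero.1 (abs_nonpos_iff.1 this)

theorem isMinOn_abs_sub_of_eq {h : ℝ → ℝ} {s : Set ℝ} {m ξ : ℝ} (hm : h ξ = m) :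
    IsMinOn (fun x => |h x - m|) s ξ := fun x _ => by simp [hm]

/-- Either the target is attained on `[b, N]`, and then every minimizer attains it, or it exceeds `h
N`, and then every minimizer has at least the value `h N`. Continuity left of `b` plays no role,
which allows a jump at `1/2`. -/
theorem exists_isMinOn_of_ge {h : ℝ → ℝ} (hmono : Monotone h) {a b N m : ℝ}
    (hbN : b ≤ N) (hab : a ≤ b) (hc : ContinuousOn h (Icc b N)) (hm : h b ≤ m) :
    (∃ ξ ∈ Icc a N, IsMinOn (fun x => |h x - m|) (Icc a N) ξ) ∧
      ∀ g ∈ Icc a N, IsMinOn (fun x => |h x - m|) (Icc a N) g → h b ≤ h g ∧ h g ≤ m := by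
  rcases le_or_gt m (h N) with hN | hN
  · obtain ⟨ξ, hξ, hξm⟩ := intermediate_value_Icc hbN hc ⟨hm, hN⟩
    have hξ' : ξ ∈ Icc a N := ⟨hab.trans hξ.1, hξ.2⟩
    refine ⟨⟨ξ, hξ', isMinOn_abs_sub_of_eq hξm⟩, fun g _ hg => ?_⟩
    rw [eq_of_isMinOn_abs_sub hg hξ' hξm]
    exact ⟨hm, le_rfl⟩
  · have hNmem : N ∈ Icc a N := ⟨hab.trans hbN, le_rfl⟩
    have hlt : ∀ x ∈ Icc a N, h x < m := fun x hx => (hmono hx.2).trans_lt hN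
    refine ⟨⟨N, hNmem, fun x hx => ?_⟩, fun g hg hgmin => ⟨?_, (hlt g hg).le⟩⟩
    · simp only [mem_ofPred_eq]
      rw [abs_of_neg (sub_neg.2 hN), abs_of_neg (sub_neg.2 (hlt x hx))]
      linarith [hmono hx.2]
    · have : |h g - m| ≤ |h N - m| := hgmin hNmem
      rw [abs_of_neg (sub_neg.2 hN), abs_of_neg (sub_neg.2 (hlt g hg))] at this
      linarith [hmono hbN]

theorem exists_isMinOn_of_le {h : ℝ → ℝ} (hmono : Monotone h) {a b N m : ℝ}
    (hbN : b ≤ N) (hab : a ≤ b) (hc : ContinuousOn h (Icc a b)) (hm : m ≤ h b) :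
    (∃ ξ ∈ Icc a N, IsMinOn (fun x => |h x - m|) (Icc a N) ξ) ∧
      ∀ g ∈ Icc a N, IsMinOn (fun x => |h x - m|) (Icc a N) g → h g ≤ h b ∧ m ≤ h g := by
  rcases le_or_gt (h a) m with ha | ha
  · obtain ⟨ξ, hξ, hξm⟩ := intermediate_value_Icc hab hc ⟨ha, hm⟩
    have hξ' : ξ ∈ Icc a N := ⟨hξ.1, hξ.2.trans hbN⟩
    refine ⟨⟨ξ, hξ', isMinOn_abs_sub_of_eq hξm⟩, fun g _ hg => ?_⟩
    rw [eq_of_isMinOn_abs_sub hg hξ' hξm]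
    exact ⟨hm, le_rfl⟩
  · have hamem : a ∈ Icc a N := ⟨le_rfl, hab.trans hbN⟩
    have hlt : ∀ x ∈ Icc a N, m < h x := fun x hx => ha.trans_le (hmono hx.1)
    refine ⟨⟨a, hamem, fun x hx => ?_⟩, fun g hg hgmin => ⟨?_, (hlt g hg).le⟩⟩
    · simp only [mem_ofPred_eq]
      rw [abs_of_pos (sub_pos.2 ha), abs_of_pos (sub_pos.2 (hlt x hx))]
      linarith [hmono hx.1]
    · have : |h g - m| ≤ |h a - m| := hgmin hamem
      rw [abs_of_pos (sub_pos.2 ha), abs_of_pos (sub_pos.2 (hlt g hg))] at this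
      linarith [hmono hab]

end Argmin

/-! ### Offsets and their measure -/

section Offset

variable {n : ℕ} {A B : Set (E n)}

theorem mem_cthickening_iff_infDist (hne : B.Nonempty) {r : ℝ} (hr : 0 ≤ r) {p : E n} :
    p ∈ Metric.cthickening r B ↔ Metric.infDist p B ≤ r := by
  rw [Metric.mem_cthickening_iff, Metric.infDist,
    ← ENNReal.le_ofReal_iff_toReal_le (Metric.infEDist_ne_top hne) hr]

theorem measure_infDist_eq_zero [Nontrivial (E n)] (hB : IsClosed B) (hne : B.Nonempty) {r : ℝ}
    (hr : 0 < r) :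
    volume {p : E n | Metric.infDist p B = r} = 0 := by
  have h := measure_level_add_eq_zero volume (φ := fun p => Metric.infDist p B)
    (ψ := fun p => Metric.infDist p B) (α := 1) (β := 0) (c := r)
    (fun p q => by
      simpa [Real.dist_eq] using (Metric.lipschitz_infDist_pt B).dist_le_mul p q)
    (fun p q => by
      simpa [Real.dist_eq] using (Metric.lipschitz_infDist_pt B).dist_le_mul p q)
    (by simp) (Eventually.of_forall fun p hp => by
      obtain ⟨z, hz, hd⟩ := hB.exists_infDist_eq_dist hne p
      have hp : Metric.infDist p B = r := by simpa using hp
      refine ⟨z, fun hzp => hr.ne ?_, ?_⟩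
      · rw [← hp, hd, hzp, dist_self]
      · rw [Metric.infDist_zero_of_mem hz, hd, zero_sub, abs_neg, abs_of_nonneg dist_nonneg,
          dist_comm])
  simpa using h

theorem measure_frontier_cthickening [Nontrivial (E n)] (hB : B ∈ JSet n) (hne : B.Nonempty)
    {r : ℝ} (hr : 0 ≤ r) : volume (frontier (Metric.cthickening r B)) = 0 := by
  rcases hr.eq_or_lt with rfl | hr
  · rw [Metric.cthickening_zero, (JSet.isClosed hB).closure_eq]
    exact hB.2.2
  · refine measure_mono_null (fun p hp => ?_) (measure_infDist_eq_zero (JSet.isClosed hB) hne hr)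
    have hset : Metric.cthickening r B = {p | Metric.infDist p B ≤ r} := by
      ext p; exact mem_cthickening_iff_infDist hne hr.le
    rw [hset] at hp
    exact frontier_le_subset_eq (Metric.continuous_infDist_pt B) continuous_const hp

theorem continuousOn_measure_cthickening_inter [Nontrivial (E n)] (hA : A ∈ JSet n)
    (hB : B ∈ JSet n) (hne : B.Nonempty) :
    ContinuousOn (fun r => volume.real (Metric.cthickening r B ∩ A)) (Ici 0) := by
  intro r hr
  have hr : 0 ≤ r := hr
  have hmeas : ∀ r, MeasurableSet (Metric.cthickening r B ∩ A) := fun r =>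
    Metric.isClosed_cthickening.measurableSet.inter (JSet.measurableSet hA)
  refine (ENNReal.tendsto_toReal
    (measure_ne_top_of_subset inter_subset_right (JSet.ne_top hA))).comp ?_
  refine tendsto_measure_of_ae_tendsto_indicator _ (hmeas r) hmeas (JSet.measurableSet hA)
    (JSet.ne_top hA) (Eventually.of_forall fun _ => inter_subset_right) ?_
  -- At radius 0 the level set is `B`, which need not be null, but its points belong to all offsets.
  have hae : ∀ᵐ p : E n, p ∈ B ∨ Metric.infDist p B ≠ r := by
    rcases hr.eq_or_lt with rfl | hr
    · refine Eventually.of_forall fun p => or_iff_not_imp_left.2 fun hp h => hp ?_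
      exact ((JSet.isClosed hB).mem_iff_infDist_zero hne).2 h
    · filter_upwards [measure_eq_zero_iff_ae_notMem.1
        (measure_infDist_eq_zero (JSet.isClosed hB) hne hr)] with p hp using Or.inr hp
  filter_upwards [hae] with p hp
  suffices ∀ᶠ s in 𝓝[Ici 0] r, (p ∈ Metric.cthickening s B ↔ p ∈ Metric.cthickening r B) by
    filter_upwards [this] with s hs
    rw [mem_inter_iff, mem_inter_iff, hs]
  have h0 : ∀ᶠ s in 𝓝[Ici 0] r, 0 ≤ s := self_mem_nhdsWithin
  rcases hp with hp | hp
  · filter_upwards [h0] with s hs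
    rw [mem_cthickening_iff_infDist hne hs, mem_cthickening_iff_infDist hne hr,
      Metric.infDist_zero_of_mem hp]
    exact iff_of_true hs hr
  · rcases lt_or_gt_of_ne hp with h | h
    · filter_upwards [h0, mem_nhdsWithin_of_mem_nhds (Ioi_mem_nhds h)] with s hs hs'
      rw [mem_cthickening_iff_infDist hne hs, mem_cthickening_iff_infDist hne hr]
      exact iff_of_true (le_of_lt hs') h.le
    · filter_upwards [h0, mem_nhdsWithin_of_mem_nhds (Iio_mem_nhds h)] with s hs hs'
      rw [mem_cthickening_iff_infDist hne hs, mem_cthickening_iff_infDist hne hr]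
      exact iff_of_false (not_le.2 hs') (not_le.2 h)

theorem exists_subset_cthickening (hA : A ∈ JSet n) (hne : B.Nonempty) :
    ∃ r, 0 ≤ r ∧ A ⊆ Metric.cthickening r B := by
  obtain ⟨b, hb⟩ := hne
  obtain ⟨R, hR⟩ := hA.1.subset_closedBall b
  refine ⟨max R 0, le_max_right _ _, fun p hp => ?_⟩
  rw [mem_cthickening_iff_infDist ⟨b, hb⟩ (le_max_right _ _)]
  exact (Metric.infDist_le_dist_of_mem hb).trans ((hR hp).trans (le_max_left _ _))

theorem radii_nonempty [Nontrivial (E n)] (hA : A ∈ JSet n) (hB : B ∈ JSet n) (hne : B.Nonempty)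
    (hBA : B ⊆ A) {t : ℝ} (ht : t ∈ Icc (0 : ℝ) 1) : (radii A B t).Nonempty := by
  obtain ⟨R, hR0, hR⟩ := exists_subset_cthickening hA hne
  have hle : volume.real B ≤ volume.real A := measureReal_mono hBA (JSet.ne_top hA)
  have h0 : volume.real (Metric.cthickening 0 B ∩ A) = volume.real B := by
    rw [Metric.cthickening_zero, (JSet.isClosed hB).closure_eq, inter_eq_left.2 hBA]
  have h1 : volume.real (Metric.cthickening R B ∩ A) = volume.real A := by
    rw [inter_eq_right.2 hR]
  obtain ⟨r, hr, hm⟩ := intermediate_value_Icc hR0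
    ((continuousOn_measure_cthickening_inter hA hB hne).mono Icc_subset_Ici_self)
    (show measAvg t A B ∈ _ by
      simp only [h0, h1]
      change _ ≤ t * volume.real A + (1 - t) * volume.real B ∧
        t * volume.real A + (1 - t) * volume.real B ≤ _
      constructor <;> nlinarith [ht.1, ht.2])
  exact ⟨r, hr.1, hm⟩

end Offset

/-- The properties of an average `R = tA ⊕ (1 - t)B` of nested sets `B ⊆ A`: it lies between the
sets for `t ∈ [0, 1]`, and beyond `A` or `B` otherwise, with bounds on the measure of the parts
that separate it from `B` and, for `t ∈ [0, 1]`, from `A`. -/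
structure IsNestedAvg {n : ℕ} (t : ℝ) (A B R : Set (E n)) : Prop where
  mem : R ∈ JSet n
  base_subset : 0 ≤ t → B ⊆ R
  measure_diff_base : 0 ≤ t → volume.real (R \ B) ≤ t * volume.real (A \ B)
  subset_top : 0 ≤ t → t ≤ 1 → R ⊆ A
  measure_top_diff : 0 ≤ t → t ≤ 1 → volume.real (A \ R) ≤ (1 - t) * volume.real (A \ B)
  top_subset : 1 < t → A ⊆ R
  subset_base : t < 0 → R ⊆ B
  measure_base_diff : t < 0 → volume.real (B \ R) ≤ -t * volume.real (A \ B)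

/-! ### Averages of a single nested piece -/

section SimpleAvg

variable {n : ℕ} {A B : Set (E n)}

theorem JSet.measureReal_diff (hA : A ∈ JSet n) (hB : B ∈ JSet n) (h : B ⊆ A) :
    volume.real (A \ B) = volume.real A - volume.real B :=
  measureReal_sdiff h (JSet.measurableSet hB) (JSet.ne_top hA)

theorem JSet.measureReal_lt (hA : A ∈ JSet n) (hB : B ∈ JSet n) (h : B ⊆ A) (hne : B ≠ A) :
    volume.real B < volume.real A := by
  rw [← sub_pos, ← JSet.measureReal_diff hA hB h]
  refine measureReal_nonneg.lt_of_ne fun h0 => hne ?_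
  have hnull : volume (A \ B) = 0 :=
    (measureReal_eq_zero_iff (measure_ne_top_of_subset sdiff_subset (JSet.ne_top hA))).1 h0.symm
  exact h.antisymm (JSet.subset_of_ae_le hA (JSet.isClosed hB) (ae_le_set.2 hnull))

theorem measAvg_eq (t : ℝ) (A B : Set (E n)) :
    measAvg t A B = volume.real B + t * (volume.real A - volume.real B) := by
  change t * volume.real A + (1 - t) * volume.real B = _
  ring

/-- For nested sets the measure of a difference is a difference of measures, so inclusions and
one-sided bounds on the measure of `R` suffice. -/
theorem IsNestedAvg.of_measure {t : ℝ} {R : Set (E n)} (hA : A ∈ JSet n) (hB : B ∈ JSet n)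
    (hBA : B ⊆ A) (hR : R ∈ JSet n)
    (h01 : 0 ≤ t → t ≤ 1 → B ⊆ R ∧ R ⊆ A ∧ volume.real R = measAvg t A B)
    (h1 : 1 < t → A ⊆ R ∧ volume.real R ≤ measAvg t A B)
    (h0 : t < 0 → R ⊆ B ∧ measAvg t A B ≤ volume.real R) : IsNestedAvg t A B R := by
  have hpos : 0 ≤ t → B ⊆ R ∧ volume.real R ≤ measAvg t A B := fun ht => by
    rcases le_or_gt t 1 with ht1 | ht1
    · obtain ⟨h, -, h'⟩ := h01 ht ht1
      exact ⟨h, h'.le⟩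
    · exact ⟨hBA.trans (h1 ht1).1, (h1 ht1).2⟩
  refine ⟨hR, fun ht => (hpos ht).1, fun ht => ?_, fun ht ht' => (h01 ht ht').2.1, fun ht ht' => ?_,
    fun ht => (h1 ht).1, fun ht => (h0 ht).1, fun ht => ?_⟩
  · rw [JSet.measureReal_diff hR hB (hpos ht).1, JSet.measureReal_diff hA hB hBA]
    have := (hpos ht).2
    rw [measAvg_eq] at this
    linarith
  · rw [JSet.measureReal_diff hA hR (h01 ht ht').2.1, JSet.measureReal_diff hA hB hBA,
      (h01 ht ht').2.2, measAvg_eq]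
    linarith
  · rw [JSet.measureReal_diff hB hR (h0 ht).1, JSet.measureReal_diff hA hB hBA]
    have := (h0 ht).2
    rw [measAvg_eq] at this
    linarith

variable [Nontrivial (E n)] (c : Choices n)

theorem Choices.isNestedAvg_cthickening (hA : A ∈ JSet n) (hB : B ∈ JSet n) (hBA : B ⊆ A)
    (hne : B.Nonempty) {t : ℝ} (ht : t ∈ Icc (0 : ℝ) 1) :
    IsNestedAvg t A B (ci (Metric.cthickening (c.r A B t) B ∩ A)) := by
  obtain ⟨hr0, hr⟩ := c.r_spec A B t (radii_nonempty hA hB hne hBA ht)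
  set D := Metric.cthickening (c.r A B t) B ∩ A
  have hfr : volume (frontier D) = 0 :=
    measure_frontier_inter_eq_zero (measure_frontier_cthickening hB hne hr0) hA.2.2
  have hmem : ci D ∈ JSet n := ci_mem_JSet (hA.1.subset inter_subset_right) hfr
  have hBD : B ⊆ D := subset_inter (Metric.self_subset_cthickening B) hBA
  refine .of_measure hA hB hBA hmem (fun _ _ => ⟨?_, ?_, ?_⟩) (fun h => absurd h (not_lt.2 ht.2))
    (fun h => absurd h (not_lt.2 ht.1))
  · have := ci_mono hBD
    rwa [← hB.2.1] at this
  · exact ci_subset (JSet.isClosed hA) inter_subset_right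
  · rw [measureReal_congr (ci_ae_eq hfr)]; exact hr

omit [Nontrivial (E n)] in
/-- A closed set which is regular compact and Jordan measurable up to a null set, or whose
frontier is a null set, is changed by `ci` only in a null set. -/
theorem ci_mem_JSet_and_ae_eq {D : Set (E n)} (hb : Bornology.IsBounded D) (hD : IsClosed D)
    (h : volume (frontier D) = 0 ∨ ∃ K ∈ JSet n, D =ᵐ[volume] K) :
    ci D ∈ JSet n ∧ ci D =ᵐ[volume] D := by
  rcases h with h | ⟨K, hK, h⟩
  · exact ⟨ci_mem_JSet hb h, ci_ae_eq h⟩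
  · rw [JSet.ci_eq_of_ae_eq hK hD h]
    exact ⟨hK, h.symm⟩

/-- Only the value of `h` at the chosen minimizer is used: compared with its values at 0 and 1 it
yields the inclusions, first almost everywhere and then genuinely by regularity. -/
theorem Choices.isNestedAvg_distAvg (hA : A ∈ JSet n) (hB : B ∈ JSet n) (hBA : B ⊆ A)
    (hne : B ≠ A) {t : ℝ} (ht : c.ZeroMeasure A B ∨ t ∉ Icc (0 : ℝ) 1) :
    IsNestedAvg t A B (ci (c.distAvg (c.g A B t) A B)) := by
  have hAne : A.Nonempty := by
    rw [nonempty_iff_ne_empty]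
    rintro rfl
    exact hne (subset_empty_iff.1 hBA)
  have hlt := JSet.measureReal_lt hA hB hBA hne
  have hN := c.one_le_N A B
  have hmono := c.h_mono hA hB hBA hAne
  have hh0 : c.h A B 0 = volume.real B := c.h_zero hB hAne
  have hh1 : c.h A B 1 = volume.real A := c.h_one hA hAne
  have hcont : ∀ x, x ≠ 1 / 2 → ContinuousAt (c.h A B) x := fun x hx =>
    c.continuousAt_h hA hB hBA hAne (c.measure_f_eq_zero hA hB hx)
  have hD0 : c.distAvg 0 A B =ᵐ[volume] B := c.distAvg_zero_ae_eq hB hAne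
  have hD1 : c.distAvg 1 A B =ᵐ[volume] A := .of_eq (c.distAvg_one hA hAne)
  have hle : ∀ {x y}, c.h A B x ≤ c.h A B y → c.distAvg x A B ≤ᵐ[volume] c.distAvg y A B :=
    fun h => c.distAvg_ae_le hA hB hBA hAne h
  have hgspec := c.g_spec A B t
  have hm := measAvg_eq t A B
  -- the measures selected by the minimization
  have h01 : 0 ≤ t → t ≤ 1 → c.h A B (c.g A B t) = measAvg t A B := fun h0 h1 => by
    have hzero : c.ZeroMeasure A B := ht.resolve_right fun h => h ⟨h0, h1⟩
    have hcont' : Continuous (c.h A B) := continuous_iff_continuousAt.2 fun x => by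
      rcases eq_or_ne x (1 / 2) with rfl | hx
      · exact c.continuousAt_h hA hB hBA hAne hzero
      · exact hcont x hx
    obtain ⟨ξ, hξ, hξm⟩ := intermediate_value_Icc zero_le_one hcont'.continuousOn
      (show measAvg t A B ∈ _ by rw [hh0, hh1, hm]; constructor <;> nlinarith)
    -- Since `1 ≤ N`, the exact solution in `[0, 1]` is among the competitors.
    have hξ' : ξ ∈ Icc (-c.N A B) (c.N A B) := ⟨by linarith [hξ.1], by linarith [hξ.2]⟩
    exact eq_of_isMinOn_abs_sub (hgspec ⟨ξ, hξ', isMinOn_abs_sub_of_eq hξm⟩).2 hξ' hξm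
  have h1 : 1 < t → c.h A B 1 ≤ c.h A B (c.g A B t) ∧ c.h A B (c.g A B t) ≤ measAvg t A B :=
    fun h1 => by
      obtain ⟨⟨ξ, hξ⟩, h⟩ := exists_isMinOn_of_ge hmono (a := -c.N A B) (b := 1) (m := measAvg t A B)
        hN (by linarith) (fun x hx => (hcont x (by linarith [hx.1])).continuousWithinAt)
        (by rw [hh1, hm]; nlinarith)
      obtain ⟨hg, hgmin⟩ := hgspec ⟨ξ, hξ⟩
      exact h _ hg hgmin
  have h0 : t < 0 → c.h A B (c.g A B t) ≤ c.h A B 0 ∧ measAvg t A B ≤ c.h A B (c.g A B t) :=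
    fun h0 => by
      obtain ⟨⟨ξ, hξ⟩, h⟩ := exists_isMinOn_of_le hmono (a := -c.N A B) (b := 0) (m := measAvg t A B)
        (zero_le_one.trans hN) (by linarith)
        (fun x hx => (hcont x (by linarith [hx.2])).continuousWithinAt)
        (by rw [hh0, hm]; nlinarith)
      obtain ⟨hg, hgmin⟩ := hgspec ⟨ξ, hξ⟩
      exact h _ hg hgmin
  generalize c.g A B t = g at *
  have hfr : c.ZeroMeasure A B ∨ g ≠ 1 / 2 → volume (frontier (c.distAvg g A B)) = 0 := fun h => by
    refine measure_mono_null (c.frontier_distAvg_subset hAne B g) ?_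
    rcases eq_or_ne g (1 / 2) with rfl | hg
    · exact h.resolve_right fun h => h rfl
    · exact c.measure_f_eq_zero hA hB hg
  have hcl : IsClosed (c.distAvg g A B) := c.isClosed_distAvg hAne B g
  -- if the frontier fails to be null then the average is one of the given sets
  obtain ⟨hmem, hae⟩ := ci_mem_JSet_and_ae_eq (c.isBounded_distAvg hA hB hBA hAne g) hcl (by
    by_cases hz : c.ZeroMeasure A B ∨ g ≠ 1 / 2
    · exact Or.inl (hfr hz)
    · rw [not_or, not_not] at hz
      obtain ⟨hz, rfl⟩ := hz
      right
      -- For extrapolation `h` at `1/2` is at most `h 0` or at least `h 1`; by monotonicity equality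
      -- holds, so the average is `B` or `A` up to a null set.
      rcases lt_or_ge t 0 with ht0 | ht0
      · exact ⟨B, hB, ((hle (h0 ht0).1).antisymm (hle (hmono (by norm_num)))).trans hD0⟩
      · have ht1 : 1 < t := not_le.1 fun h => (ht.resolve_left hz) ⟨ht0, h⟩
        exact ⟨A, hA, ((hle (hmono (by norm_num))).antisymm (hle (h1 ht1).1)).trans hD1⟩)
  have hmeas : volume.real (ci (c.distAvg g A B)) = c.h A B g := measureReal_congr hae
  have hsub : ∀ {K : Set (E n)}, IsClosed K → c.distAvg g A B ≤ᵐ[volume] K →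
      ci (c.distAvg g A B) ⊆ K := fun hK h => JSet.subset_of_ae_le hmem hK (hae.le.trans h)
  have hsup : ∀ {K : Set (E n)}, K ∈ JSet n → K ≤ᵐ[volume] c.distAvg g A B →
      K ⊆ ci (c.distAvg g A B) := fun hK h =>
    JSet.subset_of_ae_le hK (isClosed_ci _) (h.trans hae.symm.le)
  refine .of_measure hA hB hBA hmem (fun ht0 ht1 => ?_) (fun ht1 => ?_) (fun ht0 => ?_)
  · have hg := h01 ht0 ht1
    refine ⟨hsup hB (hD0.symm.le.trans (hle ?_)), hsub (JSet.isClosed hA) ((hle ?_).trans hD1.le),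
      hmeas.trans hg⟩
    · rw [hg, hh0, hm]; nlinarith
    · rw [hg, hh1, hm]; nlinarith
  · exact ⟨hsup hA (hD1.symm.le.trans (hle (h1 ht1).1)), hmeas.le.trans (h1 ht1).2⟩
  · exact ⟨hsub (JSet.isClosed hB) ((hle (h0 ht0).1).trans hD0.le), (h0 ht0).2.trans hmeas.ge⟩

theorem Choices.isNestedAvg_simpleAvg (hA : A ∈ JSet n) (hB : B ∈ JSet n) (hBA : B ⊆ A)
    (hne : B ≠ A) (t : ℝ) : IsNestedAvg t A B (c.simpleAvg t A B) := by
  unfold Choices.simpleAvg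
  split_ifs with h
  · exact c.isNestedAvg_distAvg hA hB hBA hne h
  · rw [not_or, not_not] at h
    -- Offsets of the empty set are useless, but for empty `B` the zero-measure condition holds.
    refine c.isNestedAvg_cthickening hA hB hBA ?_ h.2
    rw [nonempty_iff_ne_empty]
    rintro rfl
    exact h.1 (c.zeroMeasure_empty hA (nonempty_iff_ne_empty.2 hne.symm))

end SimpleAvg

/-! ### Connected components of a difference -/

section Components

variable {n : ℕ} {D S C : Set (E n)}

theorem components.nonempty (hC : C ∈ components D) : C.Nonempty := by
  obtain ⟨x, hx, rfl⟩ := hC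
  exact ⟨x, mem_connectedComponentIn hx⟩

theorem components.subset (hC : C ∈ components D) : C ⊆ D := by
  obtain ⟨x, -, rfl⟩ := hC
  exact connectedComponentIn_subset D x

theorem components.connectedComponentIn_eq (hC : C ∈ components D) {x : E n} (hx : x ∈ C) :
    connectedComponentIn D x = C := by
  obtain ⟨y, -, rfl⟩ := hC
  exact (_root_.connectedComponentIn_eq hx).symm

theorem components.pairwiseDisjoint (D : Set (E n)) :
    (components D).Pairwise Disjoint := fun _ hC _ hC' hne =>
  Set.disjoint_left.2 fun _ hx hx' => hne <|
    (components.connectedComponentIn_eq hC hx).symm.trans (components.connectedComponentIn_eq hC' hx')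

theorem sUnion_components (D : Set (E n)) : ⋃₀ components D = D :=
  Subset.antisymm (sUnion_subset fun _ hC => components.subset hC) fun x hx =>
    ⟨_, ⟨x, hx, rfl⟩, mem_connectedComponentIn hx⟩

theorem components.eq_inter_closure (hC : C ∈ components D) : C = D ∩ closure C := by
  refine Subset.antisymm (subset_inter (components.subset hC) subset_closure) ?_
  obtain ⟨x, hx, rfl⟩ := hC
  have hxC := mem_connectedComponentIn hx
  refine IsPreconnected.subset_connectedComponentIn
    (isPreconnected_connectedComponentIn.subset_closure (subset_inter
      (connectedComponentIn_subset D x) subset_closure) inter_subset_right)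
    ⟨hx, subset_closure hxC⟩ inter_subset_left

/-- The complement in `D` of finitely many components is relatively open. -/
theorem exists_isOpen_diff_sUnion_eq {𝒞 : Set (Set (E n))} (h𝒞 : 𝒞 ⊆ components D)
    (hfin : 𝒞.Finite) : ∃ O, IsOpen O ∧ D \ ⋃₀ 𝒞 = D ∩ O := by
  refine ⟨(⋃ C ∈ 𝒞, closure C)ᶜ, (hfin.isClosed_biUnion fun _ _ => isClosed_closure).isOpen_compl, ?_⟩
  ext x
  simp only [Set.mem_sdiff, mem_sUnion, not_exists, not_and, mem_inter_iff, mem_compl_iff, mem_iUnion,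
    exists_prop, and_congr_right_iff]
  refine fun hx => forall₂_congr fun C hC => not_congr ⟨fun h => subset_closure h, fun h => ?_⟩
  rw [components.eq_inter_closure (h𝒞 hC)]
  exact ⟨hx, h⟩

theorem diff_sUnion_components_sep (D : Set (E n)) (p : Set (E n) → Prop) :
    D \ ⋃₀ {C ∈ components D | ¬p C} = ⋃₀ {C ∈ components D | p C} := by
  ext x
  constructor
  · rintro ⟨hx, hxn⟩
    refine ⟨connectedComponentIn D x, ⟨⟨x, hx, rfl⟩, ?_⟩, mem_connectedComponentIn hx⟩
    by_contra hp
    exact hxn ⟨_, ⟨⟨x, hx, rfl⟩, hp⟩, mem_connectedComponentIn hx⟩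
  · rintro ⟨C, ⟨hC, hp⟩, hxC⟩
    refine ⟨components.subset hC hxC, ?_⟩
    rintro ⟨C', ⟨hC', hp'⟩, hxC'⟩
    rw [← components.connectedComponentIn_eq hC' hxC',
      components.connectedComponentIn_eq hC hxC] at hp'
    exact hp' hp

theorem connectedComponentIn_subset_sUnion {𝒞 : Set (Set (E n))} (h𝒞 : 𝒞 ⊆ components D) {x : E n}
    (hx : x ∈ ⋃₀ 𝒞) : connectedComponentIn D x ⊆ ⋃₀ 𝒞 := by
  obtain ⟨C, hC, hxC⟩ := hx
  rw [components.connectedComponentIn_eq (h𝒞 hC) hxC]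
  exact subset_sUnion_of_mem hC

variable {A B : Set (E n)}

/-- Attaching to `B` some of the components of `A \ B` creates no new boundary. -/
theorem frontier_union_subset_of_components (hA : IsClosed A) (hBA : B ⊆ A) (hS : S ⊆ A \ B)
    (hsat : ∀ x ∈ S, connectedComponentIn (A \ B) x ⊆ S) (hB : IsClosed B) :
    frontier (B ∪ S) ⊆ frontier A ∪ frontier B := by
  intro p ⟨hp, hpi⟩
  have hpA : p ∈ A := closure_minimal (union_subset hBA (hS.trans sdiff_subset)) hA hp
  by_cases hpB : p ∈ B
  · exact Or.inr ⟨subset_closure hpB, fun h => hpi (interior_mono subset_union_left h)⟩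
  refine Or.inl ⟨subset_closure hpA, fun hpiA => hpi ?_⟩
  -- A ball in `A \ B` that meets `S` is connected, so it lies in a single component and thus in
  -- `S`.
  obtain ⟨ε, hε, hball⟩ := Metric.isOpen_iff.1 (isOpen_interior.sdiff hB) p ⟨hpiA, hpB⟩
  have hballD : Metric.ball p ε ⊆ A \ B := hball.trans (sdiff_subset_sdiff_left interior_subset)
  obtain ⟨y, hy, hyS⟩ := mem_closure_iff_nhds.1 hp _ (Metric.ball_mem_nhds p hε)
  have hyS : y ∈ S := hyS.resolve_left (hballD hy).2
  have hsub : Metric.ball p ε ⊆ S :=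
    ((convex_ball p ε).isPreconnected.subset_connectedComponentIn hy hballD).trans (hsat y hyS)
  exact mem_interior.2 ⟨_, hsub.trans subset_union_right, Metric.isOpen_ball, Metric.mem_ball_self hε⟩

/-- Points of `A` are limits of interior points of `A`, and near the given point these stay in the
open set `Bᶜ ∩ O`. -/
theorem subset_ci_of_relOpen (hA : A ∈ JSet n) (hB : IsClosed B) {O : Set (E n)} (hO : IsOpen O) :
    (A \ B) ∩ O ⊆ ci ((A \ B) ∩ O) := by
  rintro x ⟨⟨hxA, hxB⟩, hxO⟩
  rw [hA.2.1] at hxA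
  have hopen : IsOpen (Bᶜ ∩ O) := hB.isOpen_compl.inter hO
  refine closure_mono (interior_maximal ?_ (hopen.inter isOpen_interior))
    (hopen.inter_closure ⟨⟨hxB, hxO⟩, hxA⟩)
  rintro y ⟨⟨hyB, hyO⟩, hyA⟩
  exact ⟨⟨interior_subset hyA, hyB⟩, hyO⟩

theorem measure_ne_zero_of_subset_ci (hS : S.Nonempty) (h : S ⊆ ci S) : volume S ≠ 0 := fun h0 => by
  have hint : (interior S).Nonempty := closure_nonempty_iff.1 (hS.mono h)
  exact (isOpen_interior.measure_pos volume hint).ne' (measure_mono_null interior_subset h0)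

end Components

/-- A finite family of regular compact Jordan measurable sets between `B` and `A` whose
differences with `B` decompose `A \ B` up to null sets. -/
structure IsDecomposition {n : ℕ} (A B : Set (E n)) (𝒯 : Set (Set (E n))) : Prop where
  finite : 𝒯.Finite
  mem : ∀ T ∈ 𝒯, T ∈ JSet n
  base_subset : ∀ T ∈ 𝒯, B ⊆ T
  ne : ∀ T ∈ 𝒯, B ≠ T
  subset_top : ∀ T ∈ 𝒯, T ⊆ A
  aedisjoint : 𝒯.Pairwise fun T T' => AEDisjoint volume (T \ B) (T' \ B)
  cover : volume (A \ ⋃₀ 𝒯) = 0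

/-! ### Decomposition into pieces and averages of nested sets -/

section Decomposition

variable {n : ℕ} {A B : Set (E n)}

/-- Unions of components add no boundary beyond those of `A` and `B`, so `ci` alters each piece only
in a null set. This covers finitely and infinitely many components alike. -/
theorem isDecomposition_image (hA : A ∈ JSet n) (hB : B ∈ JSet n) (hBA : B ⊆ A) (hne : B ≠ A)
    {𝒮 : Set (Set (E n))} (hfin : 𝒮.Finite) (hS : ∀ S ∈ 𝒮, volume S ≠ 0)
    (hsat : ∀ S ∈ 𝒮, ∀ x ∈ S, connectedComponentIn (A \ B) x ⊆ S)
    (hdisj : 𝒮.Pairwise Disjoint) (hcov : ⋃₀ 𝒮 = A \ B) :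
    IsDecomposition A B ((fun S => ci (B ∪ S)) '' 𝒮) := by
  have hSD : ∀ S ∈ 𝒮, S ⊆ A \ B := fun S h => hcov ▸ subset_sUnion_of_mem h
  have hSA : ∀ S ∈ 𝒮, B ∪ S ⊆ A := fun S h => union_subset hBA ((hSD S h).trans sdiff_subset)
  have hfr : ∀ S ∈ 𝒮, volume (frontier (B ∪ S)) = 0 := fun S h =>
    measure_mono_null (frontier_union_subset_of_components (JSet.isClosed hA) hBA (hSD S h)
      (hsat S h) (JSet.isClosed hB)) (measure_union_null hA.2.2 hB.2.2)
  have hae : ∀ S ∈ 𝒮, ci (B ∪ S) =ᵐ[volume] (B ∪ S : Set (E n)) := fun S h => ci_ae_eq (hfr S h)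
  have hdiff : ∀ S ∈ 𝒮, (ci (B ∪ S) \ B : Set (E n)) =ᵐ[volume] S := fun S h => by
    have h1 : (B ∪ S) \ B = S := by
      rw [union_sdiff_left]
      exact (Set.disjoint_left.2 fun x hx hxB => (hSD S h hx).2 hxB).sdiff_eq_left
    have h2 := (hae S h).diff (ae_eq_refl B)
    rwa [h1] at h2
  have hbase : ∀ S, B ⊆ ci (B ∪ S) := fun S => by
    have := ci_mono (subset_union_left (s := B) (t := S))
    rwa [← hB.2.1] at this
  refine ⟨hfin.image _, ?_, ?_, ?_, ?_, ?_, ?_⟩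
  · rintro _ ⟨S, h, rfl⟩
    exact ci_mem_JSet (hA.1.subset (hSA S h)) (hfr S h)
  · rintro _ ⟨S, h, rfl⟩
    exact hbase S
  · rintro _ ⟨S, h, rfl⟩ heq
    have h1 := measure_congr (hdiff S h)
    have heq : B = ci (B ∪ S) := heq
    rw [← heq, sdiff_self, measure_empty] at h1
    exact hS S h h1.symm
  · rintro _ ⟨S, h, rfl⟩
    exact ci_subset (JSet.isClosed hA) (hSA S h)
  · rintro _ ⟨S, h, rfl⟩ _ ⟨S', h', rfl⟩ hne'
    have hSS' : S ≠ S' := fun heq => hne' (by rw [heq])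
    exact (hdisj h h' hSS').aedisjoint.congr (hdiff S h) (hdiff S' h')
  · have hne𝒮 : 𝒮.Nonempty := by
      rw [nonempty_iff_ne_empty]
      rintro rfl
      rw [sUnion_empty] at hcov
      exact hne (hBA.antisymm (sdiff_eq_empty.1 hcov.symm))
    obtain ⟨S₀, hS₀⟩ := hne𝒮
    refine measure_mono_null (t := ⋃ S ∈ 𝒮, S \ (ci (B ∪ S) \ B)) ?_
      ((measure_biUnion_null_iff hfin.countable).2 fun S h => ae_le_set.1 (hdiff S h).symm.le)
    rintro x ⟨hxA, hx⟩
    have hxB : x ∉ B := fun hxB => hx ⟨_, ⟨S₀, hS₀, rfl⟩, hbase S₀ hxB⟩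
    have hxD : x ∈ ⋃₀ 𝒮 := hcov ▸ ⟨hxA, hxB⟩
    obtain ⟨S, h, hxS⟩ := hxD
    exact mem_biUnion h ⟨hxS, fun hxT => hx ⟨_, ⟨S, h, rfl⟩, hxT.1⟩⟩

theorem finite_components_measure_ge (hA : A ∈ JSet n) (hB : B ∈ JSet n) {ε : ℝ≥0∞} (hε : 0 < ε) :
    {C ∈ components (A \ B) | ε ≤ volume C}.Finite := by
  have hfin := Measure.finite_const_le_meas_of_disjoint_iUnion (volume : Measure (E n)) hε
    (As := fun C : components (A \ B) => (C : Set (E n)))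
    (fun C => by
      rw [components.eq_inter_closure C.2]
      exact ((JSet.measurableSet hA).diff (JSet.measurableSet hB)).inter isClosed_closure.measurableSet)
    (fun C C' hne => components.pairwiseDisjoint _ C.2 C'.2 (Subtype.coe_injective.ne hne))
    (by
      rw [← sUnion_eq_iUnion, sUnion_components]
      exact measure_ne_top_of_subset sdiff_subset (JSet.ne_top hA))
  refine (hfin.image Subtype.val).subset ?_
  rintro C ⟨hC, h⟩
  exact ⟨⟨C, hC⟩, h, rfl⟩

theorem Params.isDecomposition_tops (π : Params n) (hA : A ∈ JSet n) (hB : B ∈ JSet n)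
    (hBA : B ⊆ A) (hne : B ≠ A) : IsDecomposition A B (π.tops A B) := by
  set D := A \ B with hD
  have hBcl := JSet.isClosed hB
  have hsat : ∀ C ∈ components D, ∀ x ∈ C, connectedComponentIn D x ⊆ C := fun C hC x hx =>
    (components.connectedComponentIn_eq hC hx).subset
  have hrel : ∀ {S O}, IsOpen O → S = D ∩ O → S ⊆ ci S := fun hO h => by
    rw [h]
    exact subset_ci_of_relOpen hA hBcl hO
  unfold Params.tops
  split_ifs with hfin
  -- With finitely many components each is relatively open, as the complement of the others.
  · have hopen : ∀ C ∈ components D, C ⊆ ci C := fun C hC => by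
      obtain ⟨O, hO, h⟩ := exists_isOpen_diff_sUnion_eq (D := D)
        (sep_subset (components D) fun C' => ¬C' = C) (hfin.subset (sep_subset _ _))
      refine hrel hO ?_
      rw [← h, diff_sUnion_components_sep]
      have : {C' ∈ components D | C' = C} = {C} := by
        ext C'
        exact ⟨fun h => h.2, fun h => ⟨(show C' = C from h) ▸ hC, h⟩⟩
      rw [this, sUnion_singleton]
    have heq : (fun C => B ∪ C) '' components D = (fun C => ci (B ∪ C)) '' components D := by
      refine image_congr fun C hC => ?_
      have hcl : IsClosed (B ∪ C) := by
        have : B ∪ C = B ∪ closure C := by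
          refine Subset.antisymm (union_subset_union_right B subset_closure)
            (union_subset subset_union_left fun x hx => ?_)
          have hxA : x ∈ A := closure_minimal ((components.subset hC).trans sdiff_subset)
            (JSet.isClosed hA) hx
          by_cases hxB : x ∈ B
          · exact Or.inl hxB
          · right
            rw [components.eq_inter_closure hC]
            exact ⟨⟨hxA, hxB⟩, hx⟩
        rw [this]
        exact hBcl.union isClosed_closure
      refine Subset.antisymm (union_subset ?_ ?_) (ci_subset hcl Subset.rfl)
      · have := ci_mono (subset_union_left (s := B) (t := C))
        rwa [← hB.2.1] at this
      · exact (hopen C hC).trans (ci_mono subset_union_right)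
    rw [heq]
    exact isDecomposition_image hA hB hBA hne hfin
      (fun C hC => measure_ne_zero_of_subset_ci (components.nonempty hC) (hopen C hC)) hsat
      (components.pairwiseDisjoint D) (sUnion_components D)
  · set ε := ENNReal.ofReal (π.eps A B)
    have hε : 0 < ε := ENNReal.ofReal_pos.2 (π.eps_pos A B)
    set 𝒞 := {C ∈ components D | ε ≤ volume C} with h𝒞
    have h𝒞fin : 𝒞.Finite := finite_components_measure_ge hA hB hε
    have hU : D \ ⋃₀ 𝒞 = π.smallPart A B := by
      have := diff_sUnion_components_sep D fun C => volume C < ε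
      simp only [not_lt] at this
      exact this
    rw [← image_insert_eq (f := fun C => ci (B ∪ C))]
    have hUne : (π.smallPart A B).Nonempty := by
      have hinf : (components D \ 𝒞).Infinite := Infinite.sdiff hfin h𝒞fin
      obtain ⟨C, hC, hC'⟩ := hinf.nonempty
      obtain ⟨x, hx⟩ := components.nonempty hC
      exact ⟨x, C, ⟨hC, not_le.1 fun h => hC' ⟨hC, h⟩⟩, hx⟩
    -- The joined part is relatively open, since only finitely many components are large; being
    -- non-empty it then has positive measure.
    have hUopen : π.smallPart A B ⊆ ci (π.smallPart A B) := by
      obtain ⟨O, hO, h⟩ := exists_isOpen_diff_sUnion_eq (D := D) (sep_subset _ _) h𝒞fin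
      exact hrel hO (hU.symm.trans h)
    refine isDecomposition_image hA hB hBA hne (h𝒞fin.insert _) ?_ ?_ ?_ ?_
    · rintro S (rfl | hS)
      · exact measure_ne_zero_of_subset_ci hUne hUopen
      · exact (hε.trans_le hS.2).ne'
    · rintro S (rfl | hS) x hx
      · exact connectedComponentIn_subset_sUnion (sep_subset _ _) hx
      · exact hsat S hS.1 x hx
    · refine ((components.pairwiseDisjoint D).mono (sep_subset _ _)).insert_of_symm
        fun C hC _ => ?_
      rw [← hU]
      exact Set.disjoint_left.2 fun x hx hxC => hx.2 ⟨C, hC, hxC⟩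
    · rw [sUnion_insert, ← hU]
      exact sdiff_union_of_subset (sUnion_subset fun C hC => components.subset hC.1)

namespace IsDecomposition

variable {𝒯 : Set (Set (E n))}

theorem nonempty (h : IsDecomposition A B 𝒯) (hA : A ∈ JSet n) (hBA : B ⊆ A) (hne : B ≠ A) :
    𝒯.Nonempty := by
  rw [nonempty_iff_ne_empty]
  rintro rfl
  have h0 : A ⊆ ∅ := JSet.subset_of_ae_le hA isClosed_empty (ae_le_set.2 (by simpa using h.cover))
  exact hne (hBA.antisymm (h0.trans (empty_subset B)))

/-- Bounds relative to the members of a decomposition add up. -/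
theorem measureReal_le (h : IsDecomposition A B 𝒯) (hA : A ∈ JSet n) (hB : B ∈ JSet n)
    {X : Set (E n)} {Y : Set (E n) → Set (E n)} (hY : ∀ T ∈ 𝒯, volume (Y T) ≠ ⊤)
    (hX : X ≤ᵐ[volume] ⋃ T ∈ 𝒯, Y T) {k : ℝ} (hk : 0 ≤ k)
    (hle : ∀ T ∈ 𝒯, volume.real (Y T) ≤ k * volume.real (T \ B)) :
    volume.real X ≤ k * volume.real (A \ B) := by
  have hfin := h.finite
  have hconv : ∀ Z : Set (E n) → Set (E n), ⋃ T ∈ 𝒯, Z T = ⋃ T ∈ hfin.toFinset, Z T := fun Z => by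
    simp
  have hYtop : volume (⋃ T ∈ 𝒯, Y T) ≠ ⊤ :=
    ((measure_biUnion_lt_top hfin fun T hT => (hY T hT).lt_top)).ne
  have hTtop : ∀ T ∈ 𝒯, volume (T \ B) ≠ ⊤ := fun T hT =>
    measure_ne_top_of_subset sdiff_subset (JSet.ne_top (h.mem T hT))
  calc volume.real X ≤ volume.real (⋃ T ∈ 𝒯, Y T) :=
        ENNReal.toReal_mono hYtop (measure_mono_ae hX)
    _ ≤ ∑ T ∈ hfin.toFinset, volume.real (Y T) := by
        rw [hconv]
        exact measureReal_biUnion_finset_le _ _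
    _ ≤ ∑ T ∈ hfin.toFinset, k * volume.real (T \ B) :=
        Finset.sum_le_sum fun T hT => hle T (hfin.mem_toFinset.1 hT)
    _ = k * volume.real (⋃ T ∈ hfin.toFinset, T \ B) := by
        rw [← Finset.mul_sum, measureReal_biUnion_finset₀ (h := fun T hT =>
          hTtop T (hfin.mem_toFinset.1 hT))]
        · rw [hfin.coe_toFinset]
          exact h.aedisjoint
        · exact fun T hT => ((JSet.measurableSet (h.mem T (hfin.mem_toFinset.1 hT))).diff
            (JSet.measurableSet hB)).nullMeasurableSet
    _ ≤ k * volume.real (A \ B) := by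
        refine mul_le_mul_of_nonneg_left (measureReal_mono ?_
          (measure_ne_top_of_subset sdiff_subset (JSet.ne_top hA))) hk
        exact iUnion₂_subset fun T hT =>
          sdiff_subset_sdiff_left (h.subset_top T (hfin.mem_toFinset.1 hT))

theorem isNestedAvg_biUnion (h : IsDecomposition A B 𝒯) (hA : A ∈ JSet n) (hB : B ∈ JSet n)
    (hBA : B ⊆ A) (hne : B ≠ A) {t : ℝ} (ht : 0 ≤ t) {R : Set (E n) → Set (E n)}
    (hR : ∀ T ∈ 𝒯, IsNestedAvg t T B (R T)) : IsNestedAvg t A B (⋃ T ∈ 𝒯, R T) := by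
  have hmem : ⋃ T ∈ 𝒯, R T ∈ JSet n := JSet.biUnion h.finite fun T hT => (hR T hT).mem
  obtain ⟨T₀, hT₀⟩ := h.nonempty hA hBA hne
  refine ⟨hmem, fun _ => ?_, fun _ => ?_, fun _ ht1 => ?_, fun _ ht1 => ?_, fun ht1 => ?_,
    fun h0 => absurd h0 (not_lt.2 ht), fun h0 => absurd h0 (not_lt.2 ht)⟩
  · exact ((hR T₀ hT₀).base_subset ht).trans (subset_biUnion_of_mem hT₀)
  · refine h.measureReal_le hA hB (Y := fun T => R T \ B) (fun T hT => ?_) ?_ ht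
      fun T hT => (hR T hT).measure_diff_base ht
    · exact measure_ne_top_of_subset sdiff_subset (JSet.ne_top (hR T hT).mem)
    · refine LE.le.eventuallyLE ?_
      rintro x ⟨hx, hxB⟩
      obtain ⟨T, hT, hxT⟩ := mem_iUnion₂.1 hx
      exact mem_biUnion hT ⟨hxT, hxB⟩
  · exact iUnion₂_subset fun T hT => ((hR T hT).subset_top ht ht1).trans (h.subset_top T hT)
  · refine h.measureReal_le hA hB (Y := fun T => T \ R T) (fun T hT => ?_) ?_ (sub_nonneg.2 ht1)
      fun T hT => (hR T hT).measure_top_diff ht ht1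
    · exact measure_ne_top_of_subset sdiff_subset (JSet.ne_top (h.mem T hT))
    · rw [ae_le_set]
      refine measure_mono_null ?_ h.cover
      rintro x ⟨⟨hxA, hxR⟩, hx⟩
      refine ⟨hxA, ?_⟩
      rintro ⟨T, hT, hxT⟩
      exact hx (mem_biUnion hT ⟨hxT, fun hxR' => hxR (mem_biUnion hT hxR')⟩)
  · refine JSet.subset_of_ae_le hA (JSet.isClosed hmem) (ae_le_set.2 (measure_mono_null ?_ h.cover))
    refine sdiff_subset_sdiff_right (sUnion_subset fun T hT => ?_)
    exact ((hR T hT).top_subset ht1).trans (subset_biUnion_of_mem (u := R) hT)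

theorem isNestedAvg_ci_biInter (h : IsDecomposition A B 𝒯) (hA : A ∈ JSet n) (hB : B ∈ JSet n)
    (hBA : B ⊆ A) (hne : B ≠ A) {t : ℝ} (ht : t < 0) {R : Set (E n) → Set (E n)}
    (hR : ∀ T ∈ 𝒯, IsNestedAvg t T B (R T)) : IsNestedAvg t A B (ci (⋂ T ∈ 𝒯, R T)) := by
  obtain ⟨T₀, hT₀⟩ := h.nonempty hA hBA hne
  have hsub : ⋂ T ∈ 𝒯, R T ⊆ B := (biInter_subset_of_mem hT₀).trans ((hR T₀ hT₀).subset_base ht)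
  have hfr : volume (frontier (⋂ T ∈ 𝒯, R T)) = 0 :=
    measure_frontier_biInter_eq_zero h.finite fun T hT => (hR T hT).mem.2.2
  refine ⟨ci_mem_JSet (hB.1.subset hsub) hfr, fun h0 => absurd ht (not_lt.2 h0),
    fun h0 => absurd ht (not_lt.2 h0), fun h0 => absurd ht (not_lt.2 h0),
    fun h0 => absurd ht (not_lt.2 h0), fun h1 => absurd (h1.trans ht) (by norm_num),
    fun _ => ci_subset (JSet.isClosed hB) hsub, fun _ => ?_⟩
  refine h.measureReal_le hA hB (Y := fun T => B \ R T) (fun T hT => ?_) ?_ (by linarith)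
    fun T hT => (hR T hT).measure_base_diff ht
  · exact measure_ne_top_of_subset sdiff_subset (JSet.ne_top hB)
  · refine ((ae_eq_refl B).diff (ci_ae_eq hfr)).le.trans ?_
    refine LE.le.eventuallyLE ?_
    rintro x ⟨hxB, hx⟩
    simp only [mem_iInter, not_forall] at hx
    obtain ⟨T, hT, hxT⟩ := hx
    exact mem_biUnion hT ⟨hxB, hxT⟩

end IsDecomposition

theorem Choices.isNestedAvg_nestedAvg [Nontrivial (E n)] (c : Choices n) (hA : A ∈ JSet n)
    (hB : B ∈ JSet n) (hBA : B ⊆ A) (t : ℝ) : IsNestedAvg t A B (c.nestedAvg t A B) := by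
  unfold Choices.nestedAvg
  split_ifs with heq ht
  · subst heq
    refine ⟨hA, ?_, ?_, ?_, ?_, ?_, ?_, ?_⟩ <;> intros <;> simp
  all_goals
    have hne : B ≠ A := Ne.symm heq
    have hdec := c.isDecomposition_tops hA hB hBA hne
    have hR : ∀ T ∈ c.tops A B, IsNestedAvg t T B (c.simpleAvg t T B) := fun T hT =>
      c.isNestedAvg_simpleAvg (hdec.mem T hT) hB (hdec.base_subset T hT) (hdec.ne T hT) t
  · exact hdec.isNestedAvg_biUnion hA hB hBA hne ht hR
  · exact hdec.isNestedAvg_ci_biInter hA hB hBA hne (not_le.1 ht) hR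

end Decomposition

/-! ### Averages of general sets -/

section Average

variable {n : ℕ} {A B : Set (E n)}

theorem ci_inter_mem (hA : A ∈ JSet n) (hB : B ∈ JSet n) : ci (A ∩ B) ∈ JSet n :=
  ci_mem_JSet (hA.1.subset inter_subset_left) (measure_frontier_inter_eq_zero hA.2.2 hB.2.2)

theorem ci_inter_ae_eq (hA : A ∈ JSet n) (hB : B ∈ JSet n) :
    ci (A ∩ B) =ᵐ[volume] (A ∩ B : Set (E n)) :=
  ci_ae_eq (measure_frontier_inter_eq_zero hA.2.2 hB.2.2)

theorem ci_inter_subset (hA : A ∈ JSet n) (hB : B ∈ JSet n) : ci (A ∩ B) ⊆ A ∩ B :=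
  ci_subset ((JSet.isClosed hA).inter (JSet.isClosed hB)) Subset.rfl

theorem toReal_dMu_comm (A B : Set (E n)) : (dMu A B).toReal = (dMu B A).toReal := by
  rw [dMu, dMu, symmDiff_comm]

theorem toReal_dMu_triangle {C : Set (E n)} (hA : A ∈ JSet n) (hB : B ∈ JSet n) (hC : C ∈ JSet n) :
    (dMu A C).toReal ≤ (dMu A B).toReal + (dMu B C).toReal :=
  dist_triangle (JSet.toL A hA) (JSet.toL B hB) (JSet.toL C hC)

theorem toReal_dMu_le (A B : Set (E n)) :
    (dMu A B).toReal ≤ volume.real (A \ B) + volume.real (B \ A) :=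
  measureReal_union_le _ _

theorem measureReal_diff_ci_inter_add (hA : A ∈ JSet n) (hB : B ∈ JSet n) :
    volume.real (A \ ci (A ∩ B)) + volume.real (B \ ci (A ∩ B)) = (dMu A B).toReal := by
  have h1 : (A \ ci (A ∩ B) : Set (E n)) =ᵐ[volume] (A \ B : Set (E n)) := by
    simpa using (ae_eq_refl A).diff (ci_inter_ae_eq hA hB)
  have h2 : (B \ ci (A ∩ B) : Set (E n)) =ᵐ[volume] (B \ A : Set (E n)) := by
    simpa using (ae_eq_refl B).diff (ci_inter_ae_eq hA hB)
  rw [measureReal_congr h1, measureReal_congr h2]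
  have hdisj : Disjoint (A \ B) (B \ A) := disjoint_sdiff_sdiff
  exact (measureReal_union hdisj ((JSet.measurableSet hB).diff (JSet.measurableSet hA))
    (measure_ne_top_of_subset sdiff_subset (JSet.ne_top hA))
    (measure_ne_top_of_subset sdiff_subset (JSet.ne_top hB))).symm

variable [Nontrivial (E n)] (c : Choices n)

theorem Choices.isNestedAvg_R₁ (hA : A ∈ JSet n) (hB : B ∈ JSet n) (t : ℝ) :
    IsNestedAvg t A (ci (A ∩ B)) (c.R₁ t A B) :=
  c.isNestedAvg_nestedAvg hA (ci_inter_mem hA hB)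
    ((ci_inter_subset hA hB).trans inter_subset_left) t

theorem Choices.isNestedAvg_R₂ (hA : A ∈ JSet n) (hB : B ∈ JSet n) (t : ℝ) :
    IsNestedAvg (1 - t) B (ci (A ∩ B)) (c.R₂ t A B) :=
  c.isNestedAvg_nestedAvg hB (ci_inter_mem hA hB)
    ((ci_inter_subset hA hB).trans inter_subset_right) (1 - t)

/-- Membership and distance bounds for the average with parameter in `[0, 1]`. -/
theorem Choices.union_spec (hA : A ∈ JSet n) (hB : B ∈ JSet n) {t : ℝ} (h0 : 0 ≤ t) (h1 : t ≤ 1) :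
    c.R₁ t A B ∪ c.R₂ t A B ∈ JSet n ∧
      (dMu (c.R₁ t A B ∪ c.R₂ t A B) B).toReal ≤ t * (dMu A B).toReal ∧
      (dMu (c.R₁ t A B ∪ c.R₂ t A B) A).toReal ≤ (1 - t) * (dMu A B).toReal := by
  have hR₁ := c.isNestedAvg_R₁ hA hB t
  have hR₂ := c.isNestedAvg_R₂ hA hB t
  have hI := ci_inter_subset hA hB
  have h1' : 0 ≤ 1 - t := sub_nonneg.2 h1
  have h0' : 1 - t ≤ 1 := by linarith
  have hsum := measureReal_diff_ci_inter_add hA hB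
  have hfin : ∀ {K S : Set (E n)}, K ∈ JSet n → volume (K \ S) ≠ ⊤ := fun hK =>
    measure_ne_top_of_subset sdiff_subset (JSet.ne_top hK)
  generalize c.R₁ t A B = R₁ at *
  generalize c.R₂ t A B = R₂ at *
  generalize ci (A ∩ B) = I at *
  refine ⟨JSet.union hR₁.mem hR₂.mem, (toReal_dMu_le _ _).trans ?_, (toReal_dMu_le _ _).trans ?_⟩
  -- The excess over `B` comes from `R₁` and costs `t μ(A \ I)`; the deficit comes from `R₂` and
  -- costs `t μ(B \ I)`.
  · have e1 : volume.real ((R₁ ∪ R₂) \ B) ≤ volume.real (R₁ \ I) := by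
      refine measureReal_mono ?_ (hfin hR₁.mem)
      rintro x ⟨hx | hx, hxB⟩
      · exact ⟨hx, fun h => hxB (hI h).2⟩
      · exact absurd (hR₂.subset_top h1' h0' hx) hxB
    have e2 : volume.real (B \ (R₁ ∪ R₂)) ≤ volume.real (B \ R₂) :=
      measureReal_mono (sdiff_subset_sdiff_right subset_union_right) (hfin hB)
    rw [← hsum, mul_add]
    linarith [hR₁.measure_diff_base h0, hR₂.measure_top_diff h1' h0']
  · have e1 : volume.real ((R₁ ∪ R₂) \ A) ≤ volume.real (R₂ \ I) := by
      refine measureReal_mono ?_ (hfin hR₂.mem)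
      rintro x ⟨hx | hx, hxA⟩
      · exact absurd (hR₁.subset_top h0 h1 hx) hxA
      · exact ⟨hx, fun h => hxA (hI h).1⟩
    have e2 : volume.real (A \ (R₁ ∪ R₂)) ≤ volume.real (A \ R₁) :=
      measureReal_mono (sdiff_subset_sdiff_right subset_union_left) (hfin hA)
    rw [← hsum, mul_add]
    linarith [hR₁.measure_top_diff h0 h1, hR₂.measure_diff_base h1']

/-- Membership and distance bounds for the average with parameter larger than one. -/
theorem Choices.extraAvg_spec (hA : A ∈ JSet n) (hB : B ∈ JSet n) {t : ℝ} (ht : 1 < t) :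
    c.extraAvg t A B ∈ JSet n ∧ (dMu (c.extraAvg t A B) B).toReal ≤ t * (dMu A B).toReal ∧
      (dMu (c.extraAvg t A B) A).toReal ≤ (t - 1) * (dMu A B).toReal := by
  have hR₁ := c.isNestedAvg_R₁ hA hB t
  have hR₂ := c.isNestedAvg_R₂ hA hB t
  have hI := ci_inter_subset hA hB
  have h0 : 0 ≤ t := by linarith
  have hneg : 1 - t < 0 := by linarith
  have hsum := measureReal_diff_ci_inter_add hA hB
  have hInull : volume ((A ∩ B) \ ci (A ∩ B)) = 0 := ae_le_set.1 (ci_inter_ae_eq hA hB).symm.le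
  have hImem := ci_inter_mem hA hB
  have hfin : ∀ {K S : Set (E n)}, K ∈ JSet n → volume (K \ S) ≠ ⊤ := fun hK =>
    measure_ne_top_of_subset sdiff_subset (JSet.ne_top hK)
  unfold Choices.extraAvg
  generalize c.R₁ t A B = R₁ at *
  generalize c.R₂ t A B = R₂ at *
  generalize ci (A ∩ B) = I at *
  have hfr : volume (frontier (R₁ \ (A ∩ B))) = 0 :=
    measure_frontier_diff_eq_zero hR₁.mem.2.2 (measure_frontier_inter_eq_zero hA.2.2 hB.2.2)
  have hae : (ci (R₁ \ (A ∩ B)) ∪ R₂ : Set (E n)) =ᵐ[volume] (R₁ \ (A ∩ B) ∪ R₂ : Set (E n)) :=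
    (ci_ae_eq hfr).union (ae_eq_refl R₂)
  have hcongr : ∀ K, dMu (ci (R₁ \ (A ∩ B)) ∪ R₂) K = dMu (R₁ \ (A ∩ B) ∪ R₂) K := fun K =>
    measure_congr (hae.symmDiff (ae_eq_refl K))
  have hR₂I := hR₂.subset_base hneg
  have hdiff := hR₁.measure_diff_base h0
  have hbase := hR₂.measure_base_diff hneg
  refine ⟨JSet.union (ci_mem_JSet (hR₁.mem.1.subset sdiff_subset) hfr) hR₂.mem, ?_, ?_⟩
  · rw [hcongr]
    refine (toReal_dMu_le _ _).trans ?_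
    have e1 : volume.real ((R₁ \ (A ∩ B) ∪ R₂) \ B) ≤ volume.real (R₁ \ I) := by
      refine measureReal_mono ?_ (hfin hR₁.mem)
      rintro x ⟨hx | hx, hxB⟩
      · exact ⟨hx.1, fun h => hxB (hI h).2⟩
      · exact absurd (hI (hR₂I hx)).2 hxB
    -- The parts cost `μ(B \ I)` and `(t - 1) μ(B \ I)`, together `t μ(B \ I)`.
    have e2 : volume.real (B \ (R₁ \ (A ∩ B) ∪ R₂)) ≤
        volume.real (B \ I) + volume.real (I \ R₂) := by
      refine (measureReal_mono ?_ ?_).trans (measureReal_union_le _ _)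
      · rintro x ⟨hxB, hx⟩
        by_cases hxI : x ∈ I
        · exact Or.inr ⟨hxI, fun h => hx (Or.inr h)⟩
        · exact Or.inl ⟨hxB, hxI⟩
      · exact measure_union_ne_top (hfin hB) (hfin hImem)
    rw [← hsum, mul_add]
    linarith
  · rw [hcongr]
    refine (toReal_dMu_le _ _).trans ?_
    have hAR₁ := hR₁.top_subset ht
    have hIA : I ⊆ A := fun x hx => (hI hx).1
    have e1 : volume.real ((R₁ \ (A ∩ B) ∪ R₂) \ A) ≤ volume.real (R₁ \ A) := by
      refine measureReal_mono ?_ (hfin hR₁.mem)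
      rintro x ⟨hx | hx, hxA⟩
      · exact ⟨hx.1, hxA⟩
      · exact absurd (hI (hR₂I hx)).1 hxA
    have e2 : volume.real (R₁ \ A) = volume.real (R₁ \ I) - volume.real (A \ I) := by
      rw [JSet.measureReal_diff hR₁.mem hA hAR₁,
        JSet.measureReal_diff hR₁.mem hImem (hIA.trans hAR₁), JSet.measureReal_diff hA hImem hIA]
      ring
    -- Only `A ∩ B` was cut out of `R₁ ⊇ A`, and it agrees with `I` up to a null set.
    have e3 : volume.real (A \ (R₁ \ (A ∩ B) ∪ R₂)) ≤ volume.real (I \ R₂) := by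
      refine ENNReal.toReal_mono (hfin hImem) (measure_mono_ae (ae_le_set.2 ?_))
      refine measure_mono_null ?_ hInull
      rintro x ⟨⟨hxA, hx⟩, hxI⟩
      have hxAB : x ∈ A ∩ B := by
        by_contra h
        exact hx (Or.inl ⟨hAR₁ hxA, h⟩)
      exact ⟨hxAB, fun h => hxI ⟨h, fun h' => hx (Or.inr h')⟩⟩
    rw [← hsum, mul_add]
    linarith

/-- The measure average stays in `𝔍ₙ`, and its distance to `B` is at most `|t| d_μ(A, B)`. -/
theorem Choices.avg_mem_and_dMu_right_le (hA : A ∈ JSet n) (hB : B ∈ JSet n) (t : ℝ) :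
    c.avg t A B ∈ JSet n ∧ (dMu (c.avg t A B) B).toReal ≤ |t| * (dMu A B).toReal := by
  unfold Choices.avg
  split_ifs with h0 h1
  -- After the exchange `B` is the set extrapolated from, and its factor is `(1 - t) - 1 = |t|`.
  · obtain ⟨hm, -, hd⟩ := c.extraAvg_spec hB hA (t := 1 - t) (by linarith)
    refine ⟨hm, hd.trans_eq ?_⟩
    rw [abs_of_neg h0, toReal_dMu_comm B A]
    ring
  · obtain ⟨hm, hd, -⟩ := c.union_spec hA hB (not_lt.1 h0) h1
    rw [abs_of_nonneg (not_lt.1 h0)]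
    exact ⟨hm, hd⟩
  · obtain ⟨hm, hd, -⟩ := c.extraAvg_spec hA hB (not_le.1 h1)
    rw [abs_of_nonneg (not_lt.1 h0)]
    exact ⟨hm, hd⟩

theorem Choices.avg_mem (hA : A ∈ JSet n) (hB : B ∈ JSet n) (t : ℝ) : c.avg t A B ∈ JSet n :=
  (c.avg_mem_and_dMu_right_le hA hB t).1

theorem Choices.dMu_avg_right_le (hA : A ∈ JSet n) (hB : B ∈ JSet n) (t : ℝ) :
    (dMu (c.avg t A B) B).toReal ≤ |t| * (dMu A B).toReal :=
  (c.avg_mem_and_dMu_right_le hA hB t).2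

theorem Choices.dMu_avg_left_le (hA : A ∈ JSet n) (hB : B ∈ JSet n) {t : ℝ} (h0 : 0 ≤ t)
    (h1 : t ≤ 1) : (dMu (c.avg t A B) A).toReal ≤ (1 - t) * (dMu A B).toReal := by
  rw [Choices.avg, if_neg (not_lt.2 h0), if_pos h1]
  exact (c.union_spec hA hB h0 h1).2.2

end Average

/-! ### Contraction of the 4-point scheme -/

section Scheme

variable {n : ℕ} [Nontrivial (E n)] (c : Choices n) {w : ℝ} {F : ℤ → Set (E n)}

omit [Nontrivial (E n)] in
theorem Choices.refine_two_mul (w : ℝ) (F : ℤ → Set (E n)) (i : ℤ) :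
    c.refine w F (2 * i) = F i := by
  rw [Choices.refine, if_pos (by omega)]
  congr 1
  omega

omit [Nontrivial (E n)] in
theorem Choices.refine_two_mul_add_one (w : ℝ) (F : ℤ → Set (E n)) (i : ℤ) :
    c.refine w F (2 * i + 1) = c.avg (1 / 2) (c.avg (-2 * w) (F (i - 1)) (F i))
      (c.avg (-2 * w) (F (i + 2)) (F (i + 1))) := by
  rw [Choices.refine, if_neg (by omega)]
  have : (2 * i + 1) / 2 = i := by omega
  rw [this]

theorem Choices.refine_mem (hF : ∀ i, F i ∈ JSet n) (w : ℝ) (j : ℤ) : c.refine w F j ∈ JSet n := by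
  unfold Choices.refine
  split_ifs
  · exact hF _
  · exact c.avg_mem (c.avg_mem (hF _) (hF _) _) (c.avg_mem (hF _) (hF _) _) _

theorem Choices.dMu_refine_le (hF : ∀ i, F i ∈ JSet n) {M : ℝ}
    (hM : ∀ i, (dMu (F i) (F (i + 1))).toReal ≤ M) (w : ℝ) (j : ℤ) :
    (dMu (c.refine w F j) (c.refine w F (j + 1))).toReal ≤ (1 / 2 + 4 * |w|) * M := by
  -- Neighbours on the new level are always a new set and one of the two old sets around it. The
  -- constant is `(1 + 4|w|) / 2 + 2|w|`.
  have key : ∀ i, (dMu (c.refine w F (2 * i + 1)) (F i)).toReal ≤ (1 / 2 + 4 * |w|) * M ∧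
      (dMu (c.refine w F (2 * i + 1)) (F (i + 1))).toReal ≤ (1 / 2 + 4 * |w|) * M := fun i => by
    rw [c.refine_two_mul_add_one]
    set P := c.avg (-2 * w) (F (i - 1)) (F i)
    set Q := c.avg (-2 * w) (F (i + 2)) (F (i + 1))
    have hP : P ∈ JSet n := c.avg_mem (hF _) (hF _) _
    have hQ : Q ∈ JSet n := c.avg_mem (hF _) (hF _) _
    have habs : |-2 * w| = 2 * |w| := by rw [abs_mul]; norm_num
    have h1 : (dMu P (F i)).toReal ≤ 2 * |w| * M := by
      refine (c.dMu_avg_right_le (hF _) (hF _) _).trans ?_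
      rw [habs]
      have := hM (i - 1)
      rw [sub_add_cancel] at this
      gcongr
    have h2 : (dMu Q (F (i + 1))).toReal ≤ 2 * |w| * M := by
      refine (c.dMu_avg_right_le (hF _) (hF _) _).trans ?_
      rw [habs, toReal_dMu_comm]
      have := hM (i + 1)
      rw [add_assoc, one_add_one_eq_two] at this
      gcongr
    have h3 : (dMu P Q).toReal ≤ (1 + 4 * |w|) * M := by
      have e1 := toReal_dMu_triangle hP (hF i) hQ
      have e2 := toReal_dMu_triangle (hF i) (hF (i + 1)) hQ
      rw [toReal_dMu_comm (F (i + 1)) Q] at e2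
      linarith [hM i]
    have hR : c.avg (1 / 2) P Q ∈ JSet n := c.avg_mem hP hQ _
    have h4 := c.dMu_avg_left_le hP hQ (t := 1 / 2) (by norm_num) (by norm_num)
    have h5 := c.dMu_avg_right_le hP hQ (1 / 2)
    rw [abs_of_pos (by norm_num : (0 : ℝ) < 1 / 2)] at h5
    have h6 := toReal_dMu_triangle hR hP (hF i)
    have h7 := toReal_dMu_triangle hR hQ (hF (i + 1))
    constructor <;> linarith
  obtain ⟨i, rfl | rfl⟩ : ∃ i, j = 2 * i ∨ j = 2 * i + 1 := ⟨j / 2, by omega⟩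
  · rw [c.refine_two_mul, toReal_dMu_comm]
    exact (key i).1
  · have : 2 * i + 1 + 1 = 2 * (i + 1) := by ring
    rw [this, c.refine_two_mul w F (i + 1)]
    exact (key i).2

theorem Choices.level_mem (hF : ∀ i, F i ∈ JSet n) (w : ℝ) (k : ℕ) (i : ℤ) :
    c.level w F k i ∈ JSet n := by
  induction k generalizing i with
  | zero => exact hF i
  | succ k ih => exact c.refine_mem ih w i

theorem Choices.dMu_level_le (hF : ∀ i, F i ∈ JSet n) {M : ℝ}
    (hM : ∀ i, (dMu (F i) (F (i + 1))).toReal ≤ M) (w : ℝ) (k : ℕ) (i : ℤ) :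
    (dMu (c.level w F k i) (c.level w F k (i + 1))).toReal ≤ (1 / 2 + 4 * |w|) ^ k * M := by
  induction k generalizing i with
  | zero => simpa [Choices.level] using hM i
  | succ k ih =>
    have := c.dMu_refine_le (c.level_mem hF w k) ih w i
    rw [← mul_assoc, ← pow_succ'] at this
    exact this

omit [Nontrivial (E n)] in
theorem toReal_dMu_le_supDist (h : supDist F ≠ ⊤) (i : ℤ) :
    (dMu (F i) (F (i + 1))).toReal ≤ (supDist F).toReal :=
  ENNReal.toReal_mono h (le_iSup (fun i => dMu (F i) (F (i + 1))) i)

theorem Choices.supDist_level_le (hF : ∀ i, F i ∈ JSet n) (w : ℝ) (k : ℕ) :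
    supDist (c.level w F k) ≤ ENNReal.ofReal (1 / 2 + 4 * |w|) ^ k * supDist F := by
  have hq : 0 < 1 / 2 + 4 * |w| := by positivity
  by_cases h : supDist F = ⊤
  · rw [h, ENNReal.mul_top]
    · exact le_top
    · exact pow_ne_zero k (ENNReal.ofReal_pos.2 hq).ne'
  · refine iSup_le fun i => ?_
    have h1 := c.dMu_level_le hF (toReal_dMu_le_supDist h) w k i
    have hmem := c.level_mem hF w k
    rw [← ENNReal.ofReal_toReal (dMu_ne_top (JSet.ne_top (hmem i)) (JSet.ne_top (hmem (i + 1))))]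
    refine (ENNReal.ofReal_le_ofReal h1).trans_eq ?_
    rw [ENNReal.ofReal_mul (by positivity), ENNReal.ofReal_pow hq.le, ENNReal.ofReal_toReal h]

end Scheme

/-! ### Completeness of the space of measurable sets -/

section Complete

variable {n : ℕ}

/-- A point whose membership never switches after stage `N` is in the upper limit exactly if it is
in `u N`. -/
theorem symmDiff_iInter_iUnion_subset {X : Type*} (u : ℕ → Set X) (N : ℕ) :
    (⋂ m, ⋃ k, u (m + k)) ∆ u N ⊆ ⋃ k, u (N + k) ∆ u (N + (k + 1)) := by
  intro x
  contrapose!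
  intro hx
  simp only [mem_iUnion, not_exists, Set.mem_symmDiff, not_or, not_and, not_not] at hx
  have hiff : ∀ k, x ∈ u (N + k) ↔ x ∈ u N := fun k => by
    induction k with
    | zero => rfl
    | succ k ih => exact ⟨fun h => ih.1 ((hx k).2 h), fun h => (hx k).1 (ih.2 h)⟩
  rw [Set.mem_symmDiff, not_or, not_and_not_right, not_and_not_right]
  simp only [mem_iInter, mem_iUnion]
  refine ⟨fun h => ?_, fun h m => ⟨N, ?_⟩⟩
  · obtain ⟨k, hk⟩ := h N
    exact (hiff k).1 hk
  · rw [add_comm]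
    exact (hiff m).2 h

/-- The space `𝔏ₙ` is complete. -/
instance (n : ℕ) : CompleteSpace (LSet n) := by
  refine Metric.complete_of_convergent_controlled_sequences (fun N => (1 / 2 : ℝ) ^ N)
    (fun N => by positivity) fun u hu => ?_
  set L : Set (E n) := ⋂ m, ⋃ k, (u (m + k)).1
  have hstep : ∀ k, dMu (u k).1 (u (k + 1)).1 ≤ ENNReal.ofReal ((1 / 2) ^ k) := fun k => by
    rw [← ENNReal.ofReal_toReal (dMu_ne_top (u k).2.2 (u (k + 1)).2.2)]
    exact ENNReal.ofReal_le_ofReal (hu k k (k + 1) le_rfl (Nat.le_succ k)).le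
  have hsum : HasSum (fun k : ℕ => (1 / 2 : ℝ) ^ k) 2 := hasSum_geometric_two
  have hbound : ∀ N, volume (L ∆ (u N).1) ≤ ENNReal.ofReal ((1 / 2) ^ N * 2) := fun N => by
    calc volume (L ∆ (u N).1)
        ≤ volume (⋃ k, (u (N + k)).1 ∆ (u (N + (k + 1))).1) :=
          measure_mono (symmDiff_iInter_iUnion_subset (fun k => (u k).1) N)
      _ ≤ ∑' k, volume ((u (N + k)).1 ∆ (u (N + (k + 1))).1) := measure_iUnion_le _
      _ ≤ ∑' k, ENNReal.ofReal ((1 / 2) ^ N * (1 / 2) ^ k) := by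
          refine ENNReal.tsum_le_tsum fun k => ?_
          rw [← pow_add]
          exact hstep (N + k)
      _ = ENNReal.ofReal ((1 / 2) ^ N * 2) := by
          rw [← ENNReal.ofReal_tsum_of_nonneg (fun k => by positivity)
            (hsum.mul_left _).summable, (hsum.mul_left _).tsum_eq]
  have hmeas : NullMeasurableSet L volume :=
    NullMeasurableSet.iInter fun m => NullMeasurableSet.iUnion fun k => (u (m + k)).2.1
  have hfin : volume L ≠ ⊤ := by
    have hsub : L ⊆ (u 0).1 ∪ L ∆ (u 0).1 := fun x hx => by
      by_cases h : x ∈ (u 0).1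
      · exact Or.inl h
      · exact Or.inr (Or.inl ⟨hx, h⟩)
    exact measure_ne_top_of_subset hsub (measure_union_ne_top (u 0).2.2
      (ne_top_of_le_ne_top ENNReal.ofReal_ne_top (hbound 0)))
  obtain ⟨L', hL'⟩ : ∃ L' : LSet n, L'.1 = L := ⟨⟨L, hmeas, hfin⟩, rfl⟩
  simp only [← hL'] at hbound
  refine ⟨L', tendsto_iff_dist_tendsto_zero.2 ?_⟩
  refine squeeze_zero (g := fun N => (1 / 2 : ℝ) ^ N * 2) (fun _ => dist_nonneg) (fun N => ?_) ?_
  · rw [dist_comm]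
    exact ENNReal.toReal_le_of_le_ofReal (by positivity) (hbound N)
  · simpa using (tendsto_pow_atTop_nhds_zero_of_lt_one (r := (1 / 2 : ℝ)) (by norm_num)
      (by norm_num)).mul_const 2

end Complete

/-! ### Uniform convergence of the interpolants -/

section Limit

variable {n : ℕ} [Nontrivial (E n)] (c : Choices n) {w : ℝ} {F : ℤ → Set (E n)}

theorem Choices.interp_mem (hF : ∀ i, F i ∈ JSet n) (w : ℝ) (k : ℕ) (x : ℝ) :
    c.interp w F k x ∈ JSet n :=
  c.avg_mem (c.level_mem hF w k _) (c.level_mem hF w k _) _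

theorem Choices.dMu_interp_level_le (hF : ∀ i, F i ∈ JSet n) {k : ℕ} {M : ℝ}
    (hM : ∀ i, (dMu (c.level w F k i) (c.level w F k (i + 1))).toReal ≤ M) (x : ℝ) :
    (dMu (c.interp w F k x) (c.level w F k ⌊2 ^ k * x⌋)).toReal ≤ M := by
  have h1 := Int.floor_le (2 ^ k * x)
  have h2 := Int.lt_floor_add_one (2 ^ k * x)
  refine (c.dMu_avg_left_le (c.level_mem hF w k _) (c.level_mem hF w k _) (by linarith)
    (by linarith)).trans ?_
  refine le_trans (mul_le_of_le_one_left ENNReal.toReal_nonneg (by linarith)) (hM _)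

omit [Nontrivial (E n)] in
theorem Choices.dMu_level_le_of_near {k : ℕ} {M : ℝ}
    (hM : ∀ i, (dMu (c.level w F k i) (c.level w F k (i + 1))).toReal ≤ M) {i j : ℤ}
    (h1 : i ≤ j + 1) (h2 : j ≤ i + 1) :
    (dMu (c.level w F k i) (c.level w F k j)).toReal ≤ M := by
  obtain rfl | rfl | rfl : i = j ∨ j = i + 1 ∨ i = j + 1 := by omega
  · have : 0 ≤ M := ENNReal.toReal_nonneg.trans (hM i)
    simpa [dMu] using this
  · exact hM i
  · rw [toReal_dMu_comm]
    exact hM j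

/-- The link between the levels is the set with index `i`, kept at index `2i`; the finer floor is
`2i` or `2i + 1`. -/
theorem Choices.dMu_interp_succ_le (hF : ∀ i, F i ∈ JSet n) {k : ℕ} {M M' : ℝ}
    (hM : ∀ i, (dMu (c.level w F k i) (c.level w F k (i + 1))).toReal ≤ M)
    (hM' : ∀ i, (dMu (c.level w F (k + 1) i) (c.level w F (k + 1) (i + 1))).toReal ≤ M') (x : ℝ) :
    (dMu (c.interp w F k x) (c.interp w F (k + 1) x)).toReal ≤ M + 2 * M' := by
  set i := ⌊2 ^ k * x⌋ with hi
  set j := ⌊2 ^ (k + 1) * x⌋ with hj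
  have hpow : (2 : ℝ) ^ (k + 1) * x = 2 * (2 ^ k * x) := by ring
  have hij1 : 2 * i ≤ j := by
    rw [hj, Int.le_floor, hpow]
    push_cast
    linarith [Int.floor_le (2 ^ k * x)]
  have hij2 : j < 2 * i + 2 := by
    rw [hj, Int.floor_lt, hpow]
    push_cast
    linarith [Int.lt_floor_add_one (2 ^ k * x)]
  have heven : c.level w F (k + 1) (2 * i) = c.level w F k i := c.refine_two_mul w _ i
  have h1 := c.dMu_interp_level_le hF hM x
  have h2 := c.dMu_interp_level_le hF hM' x
  have h3 := c.dMu_level_le_of_near hM' (i := 2 * i) (j := j) (by omega) (by omega)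
  rw [heven] at h3
  have e1 := toReal_dMu_triangle (c.interp_mem hF w k x) (c.level_mem hF w k i)
    (c.interp_mem hF w (k + 1) x)
  have e2 := toReal_dMu_triangle (c.level_mem hF w k i) (c.level_mem hF w (k + 1) j)
    (c.interp_mem hF w (k + 1) x)
  rw [toReal_dMu_comm (c.level w F (k + 1) j)] at e2
  linarith

theorem Choices.dMu_interp_interp_le (hF : ∀ i, F i ∈ JSet n) {k : ℕ} {M : ℝ}
    (hM : ∀ i, (dMu (c.level w F k i) (c.level w F k (i + 1))).toReal ≤ M) {x y : ℝ}
    (hxy : |x - y| < (2 ^ k)⁻¹) :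
    (dMu (c.interp w F k x) (c.interp w F k y)).toReal ≤ 3 * M := by
  set i := ⌊2 ^ k * x⌋ with hi
  set j := ⌊2 ^ k * y⌋ with hj
  have hpow : (0 : ℝ) < 2 ^ k := by positivity
  have hlt : |2 ^ k * x - 2 ^ k * y| < 1 := by
    rw [← mul_sub, abs_mul, abs_of_pos hpow]
    exact (lt_inv_mul_iff₀ hpow).1 (by simpa using hxy)
  rw [abs_lt] at hlt
  have hij1 : i < j + 2 := by
    rw [hi, Int.floor_lt]
    push_cast
    linarith [Int.lt_floor_add_one (2 ^ k * y)]
  have hij2 : j < i + 2 := by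
    rw [hj, Int.floor_lt]
    push_cast
    linarith [Int.lt_floor_add_one (2 ^ k * x)]
  have h1 := c.dMu_interp_level_le hF hM x
  have h2 := c.dMu_interp_level_le hF hM y
  have h3 := c.dMu_level_le_of_near hM (i := i) (j := j) (by omega) (by omega)
  have e1 := toReal_dMu_triangle (c.interp_mem hF w k x) (c.level_mem hF w k i)
    (c.interp_mem hF w k y)
  have e2 := toReal_dMu_triangle (c.level_mem hF w k i) (c.level_mem hF w k j)
    (c.interp_mem hF w k y)
  rw [toReal_dMu_comm (c.level w F k j)] at e2
  linarith

theorem Choices.exists_continuous_tendstoUniformly (hF : ∀ i, F i ∈ JSet n) (hw : |w| < 1 / 8)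
    (hsup : supDist F ≠ ⊤) :
    ∃ Finf : ℝ → LSet n, Continuous Finf ∧ TendstoUniformly
      (fun k x => JSet.toL (c.interp w F k x) (c.interp_mem hF w k x)) Finf atTop := by
  set G : ℕ → ℝ → LSet n := fun k x => JSet.toL (c.interp w F k x) (c.interp_mem hF w k x)
  set M := (supDist F).toReal with hMdef
  have hM0 : 0 ≤ M := ENNReal.toReal_nonneg
  set q := 1 / 2 + 4 * |w| with hq
  have hq0 : 0 ≤ q := by positivity
  have hq1 : q < 1 := by rw [hq]; linarith
  have hM : ∀ k i, (dMu (c.level w F k i) (c.level w F k (i + 1))).toReal ≤ q ^ k * M :=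
    fun k i => c.dMu_level_le hF (toReal_dMu_le_supDist hsup) w k i
  have hstep : ∀ x k, dist (G k x) (G (k + 1) x) ≤ 3 * M * q ^ k := fun x k => by
    refine (c.dMu_interp_succ_le hF (hM k) (hM (k + 1)) x).trans ?_
    have : q ^ (k + 1) ≤ q ^ k := pow_le_pow_of_le_one hq0 hq1.le (Nat.le_succ k)
    nlinarith
  -- Continuity of the interpolants is not needed: their oscillation at scale `2^{-k}` tends to
  -- zero.
  have hnear : ∀ k x y, |x - y| < (2 ^ k)⁻¹ → dist (G k x) (G k y) ≤ 3 * M * q ^ k :=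
    fun k x y hxy => (c.dMu_interp_interp_le hF (hM k) hxy).trans_eq (by ring)
  choose Finf hFinf using fun x => cauchySeq_tendsto_of_complete
    (cauchySeq_of_le_geometric q (3 * M) hq1 (hstep x))
  have hdist : ∀ k x, dist (G k x) (Finf x) ≤ 3 * M * q ^ k / (1 - q) := fun k x =>
    dist_le_of_le_geometric_of_tendsto q (3 * M) hq1 (hstep x) (hFinf x) k
  have hpow : Tendsto (fun k => q ^ k) atTop (𝓝 0) := tendsto_pow_atTop_nhds_zero_of_lt_one hq0 hq1
  have hlim : Tendsto (fun k => 3 * M * q ^ k) atTop (𝓝 0) := by simpa using hpow.const_mul (3 * M)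
  have hlim' : Tendsto (fun k => 3 * M * q ^ k / (1 - q)) atTop (𝓝 0) := by
    simpa using hlim.div_const (1 - q)
  refine ⟨Finf, Metric.continuous_iff.2 fun x ε hε => ?_, Metric.tendstoUniformly_iff.2 fun ε hε => ?_⟩
  · have hε3 : 0 < ε / 3 := by positivity
    obtain ⟨k, hk, hk'⟩ := ((hlim.eventually_lt_const hε3).and
      (hlim'.eventually_lt_const hε3)).exists
    refine ⟨(2 ^ k)⁻¹, by positivity, fun y hy => ?_⟩
    have h1 := dist_triangle4 (Finf y) (G k y) (G k x) (Finf x)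
    rw [dist_comm (Finf y) (G k y)] at h1
    linarith [hdist k x, hdist k y, hnear k y x hy]
  · filter_upwards [hlim'.eventually_lt_const hε] with k hk x
    rw [dist_comm]
    exact (hdist k x).trans_lt hk

end Limit

end SetSubdivision

open SetSubdivision in
theorem theorem6p3 (n : ℕ) (hn : 0 < n) (c : Choices n) (w : ℝ)
    (F : ℤ → Set (EuclideanSpace ℝ (Fin n))) (hF : ∀ i, F i ∈ JSet n) :
    (∀ k i, c.level w F k i ∈ JSet n) ∧
    (∀ k, supDist (c.level w F k) ≤ ENNReal.ofReal (1 / 2 + 4 * |w|) ^ k * supDist F) ∧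
    ∃ hJ : ∀ k x, c.interp w F k x ∈ JSet n,
      |w| < 1 / 8 → supDist F ≠ ⊤ →
        ∃ Finf : ℝ → LSet n, Continuous Finf ∧
          TendstoUniformly (fun k x => JSet.toL (c.interp w F k x) (hJ k x)) Finf atTop := by
  have : NeZero n := ⟨hn.ne'⟩
  -- Positive dimension guarantees that non-empty compact sets have a non-empty frontier.
  have : Nontrivial (E n) := inferInstance
  exact ⟨c.level_mem hF w, c.supDist_level_le hF w, c.interp_mem hF w,
    fun hw hsup => c.exists_continuous_tendstoUniformly hF hw hsup⟩
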